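/- Let $k,n$ be integers with $1\le k\le n/2$, and let $$\operatorname{Gr}(k,n)=\{Q\in\mathbb{R}^{n\times n} : Q^{\mathsf T}Q=I,\ Q^{\mathsf T}=Q,\ \operatorname{tr}(Q)=2k-n\}$$ be the involution model of the Grassmannian, a smooth submanifold of $\mathbb{R}^{n\times n}$ with the Riemannian metric $\langle X,Y\rangle_Q=\operatorname{tr}(XY)$. Let $d$ be its geodesic distance, i.e. $d(Q_0,Q_1)$ is the infimum of $\int_0^1\sqrt{\operatorname{tr}(\dot\gamma(t)^2)}\,dt$ over all $C^1$ curves $\gamma:[0,1]\to\operatorname{Gr}(k,n)$ with $\gamma(0)=Q_0$, $\gamma(1)=Q_1$. Put $I_{k,n-k}=\operatorname{diag}(I_k,-I_{n-k})$. Let $Q_0,Q_1\in\operatorname{Gr}(k,n)$. Then there are $V_0,V_1\in\mathrm{O}(n)$ with $Q_0=V_0I_{k,n-k}V_0^{\mathsf T}$ and $Q_1=V_1I_{k,n-k}V_1^{\mathsf T}$, and for all such $V_0,V_1$ the matrix $V_0^{\mathsf T}V_1$ has a CS decomposition $$V_0^{\mathsf T}V_1=\begin{bmatrix}U&0\\0&V\end{bmatrix}\begin{bmatrix}\cos\Theta&\sin\Theta&0\\-\sin\Theta&\cos\Theta&0\\0&0&I_{n-2k}\end{bmatrix}\begin{bmatrix}W&0\\0&Z\end{bmatrix}^{\mathsf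 T},$$ where $U,W\in\mathrm{O}(k)$, $V,Z\in\mathrm{O}(n-k)$, and $\Theta=\operatorname{diag}(\theta_1,\dots,\theta_k)$ with $\theta_i\in[0,\pi/2]$. For every such $V_0,V_1$ and every such CS decomposition, setting $B=-2U[\Theta,0]V^{\mathsf T}\in\mathbb{R}^{k\times(n-k)}$ with singular values $\sigma_1(B)\ge\dots\ge\sigma_k(B)$, $$d(Q_0,Q_1)=\sqrt2\Bigl(\sum_{i=1}^k\sigma_i(B)^2\Bigr)^{1/2}=2\sqrt2\Bigl(\sum_{i=1}^k\theta_i^2\Bigr)^{1/2}.$$ -/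

import Mathlib

namespace InvolutionModel

noncomputable section

/-- The Grassmannian `Gr(k, n)` in the involution model: the symmetric orthogonal real `n × n`
matrices of trace `2k - n`. -/
def Gr (k n : ℕ) : Set (Matrix (Fin n) (Fin n) ℝ) :=
  {Q | Q ∈ Matrix.orthogonalGroup (Fin n) ℝ ∧ Q.transpose = Q ∧ Q.trace = 2 * (k : ℝ) - (n : ℝ)}

/-- The Riemannian metric `⟨X, Y⟩_Q = tr(XY)` on tangent vectors of `Gr(k, n)` at any point `Q`
(tangent vectors are symmetric matrices, so this is the Frobenius inner product inherited from the
ambient matrix space). -/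
def metric {n : ℕ} (X Y : Matrix (Fin n) (Fin n) ℝ) : ℝ := (X * Y).trace

/-- The Riemannian norm `‖X‖_Q = √⟨X, X⟩_Q` of a tangent vector. -/
def riemannianNorm {n : ℕ} (X : Matrix (Fin n) (Fin n) ℝ) : ℝ := Real.sqrt (metric X X)

section Curves

/- All norms on a space of matrices are equivalent; the choice of the Frobenius norm here only
serves to speak of derivatives of curves of matrices. -/
attribute [local instance] Matrix.frobeniusNormedAddCommGroup Matrix.frobeniusNormedSpace

/-- `γ`, restricted to `[0, 1]`, is a `C¹` curve in the submanifold `Gr(k, n)` of the space of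
`n × n` matrices, from `Q₀` to `Q₁`. -/
structure IsCurveFromTo (k : ℕ) {n : ℕ} (Q₀ Q₁ : Matrix (Fin n) (Fin n) ℝ)
    (γ : ℝ → Matrix (Fin n) (Fin n) ℝ) : Prop where
  contDiffOn : ContDiffOn ℝ 1 γ (Set.Icc 0 1)
  mem : ∀ t ∈ Set.Icc (0 : ℝ) 1, γ t ∈ Gr k n
  source : γ 0 = Q₀
  target : γ 1 = Q₁

/-- The Riemannian length `L(γ) = ∫₀¹ ‖γ'(t)‖ dt`. -/
def curveLength {n : ℕ} (γ : ℝ → Matrix (Fin n) (Fin n) ℝ) : ℝ :=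
  ∫ t in (0 : ℝ)..1, riemannianNorm (derivWithin γ (Set.Icc 0 1) t)

end Curves

/-- The geodesic (Riemannian) distance on `Gr(k, n)`: the infimum of the lengths of the `C¹` curves
in `Gr(k, n)` joining the two points (it would be `∞` if there were none). -/
def geodesicDist (k : ℕ) {n : ℕ} (Q₀ Q₁ : Matrix (Fin n) (Fin n) ℝ) : ENNReal :=
  ⨅ (γ : ℝ → Matrix (Fin n) (Fin n) ℝ) (_ : IsCurveFromTo k Q₀ Q₁ γ),
    ENNReal.ofReal (curveLength γ)

/-- The `n × n` matrix with blocks `[A, B; C, D]`, where `n = k + m`, the first `k` rows and columns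
being those of the first block. -/
def blockMatrix {k m n : ℕ} (h : k + m = n) (A : Matrix (Fin k) (Fin k) ℝ)
    (B : Matrix (Fin k) (Fin m) ℝ) (C : Matrix (Fin m) (Fin k) ℝ) (D : Matrix (Fin m) (Fin m) ℝ) :
    Matrix (Fin n) (Fin n) ℝ :=
  Matrix.reindex (finSumFinEquiv.trans (finCongr h)) (finSumFinEquiv.trans (finCongr h))
    (Matrix.fromBlocks A B C D)

/-- The matrix `I_{k,m} = diag(1, …, 1, -1, …, -1)` of size `n = k + m`. -/
def signature {k m n : ℕ} (h : k + m = n) : Matrix (Fin n) (Fin n) ℝ :=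
  blockMatrix h 1 0 0 (-1)

/-- The `k × m` matrix `[diag(v₁, …, v_k), 0]`, for `k ≤ m`. -/
def rectDiag {k : ℕ} (m : ℕ) (v : Fin k → ℝ) : Matrix (Fin k) (Fin m) ℝ :=
  Matrix.of fun i j => if (i : ℕ) = (j : ℕ) then v i else 0

/-- The `m × m` matrix `diag(v₁, …, v_k, 1, …, 1)`, for `k ≤ m`. -/
def paddedDiag {k : ℕ} (m : ℕ) (v : Fin k → ℝ) : Matrix (Fin m) (Fin m) ℝ :=
  Matrix.diagonal fun j => if h : (j : ℕ) < k then v ⟨j, h⟩ else 1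

/-- The middle factor `[cos Θ, sin Θ, 0; -sin Θ, cos Θ, 0; 0, 0, I]` of a CS decomposition, with
`Θ = diag(θ₁, …, θ_k)`, of size `n = k + m`, for `k ≤ m`. -/
def csMiddle {k m n : ℕ} (h : k + m = n) (θ : Fin k → ℝ) : Matrix (Fin n) (Fin n) ℝ :=
  blockMatrix h
    (Matrix.diagonal fun i => Real.cos (θ i))
    (rectDiag m fun i => Real.sin (θ i))
    (-(rectDiag m fun i => Real.sin (θ i)).transpose)
    (paddedDiag m fun i => Real.cos (θ i))

/-- `M = diag(U, V) · [cos Θ, sin Θ, 0; -sin Θ, cos Θ, 0; 0, 0, I] · diag(W, Z)ᵀ` is a CS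
decomposition of the matrix `M`, with angles `θᵢ ∈ [0, π/2]`. -/
structure IsCSDecomposition {k m n : ℕ} (h : k + m = n) (M : Matrix (Fin n) (Fin n) ℝ)
    (U W : Matrix (Fin k) (Fin k) ℝ) (V Z : Matrix (Fin m) (Fin m) ℝ) (θ : Fin k → ℝ) : Prop where
  U_mem : U ∈ Matrix.orthogonalGroup (Fin k) ℝ
  W_mem : W ∈ Matrix.orthogonalGroup (Fin k) ℝ
  V_mem : V ∈ Matrix.orthogonalGroup (Fin m) ℝ
  Z_mem : Z ∈ Matrix.orthogonalGroup (Fin m) ℝ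
  angle_mem : ∀ i, θ i ∈ Set.Icc 0 (Real.pi / 2)
  eq : M = blockMatrix h U 0 0 V * csMiddle h θ * (blockMatrix h W 0 0 Z).transpose

/-- `Q = V₀ I_{k,m} V₀ᵀ` is an eigendecomposition of `Q` with `V₀` orthogonal. -/
structure IsEigendecomposition {k m n : ℕ} (h : k + m = n) (Q V₀ : Matrix (Fin n) (Fin n) ℝ) :
    Prop where
  mem : V₀ ∈ Matrix.orthogonalGroup (Fin n) ℝ
  eq : Q = V₀ * signature h * V₀.transpose

/-- The `i`-th singular value (in decreasing order, counted from `0`) of a real matrix. -/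
def singularValue {k m : ℕ} (B : Matrix (Fin k) (Fin m) ℝ) (i : ℕ) : ℝ :=
  (Matrix.toEuclideanLin B).singularValues i

end

end InvolutionModel

/-! The upper bound comes from an explicit curve. A CS decomposition conjugates the pair `Q₀`, `Q₁`
by one orthogonal matrix to the signature and to its image under rotations by the angles `θᵢ`, since
block diagonal factors commute with the signature. Letting the angles grow linearly gives a curve of
constant speed and length `2√2 (∑ θᵢ²)^(1/2)` (`isCurveFromTo_geodesicPoint`).

The lower bound uses a function that no curve can increase faster than its own length. Fix the
starting point `P`, put `H = (PQ + QP)/2`, whose eigenvalues are the cosines of the arguments of the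
eigenvalues of `PQ`, and consider `F(Q) = (tr arccos(H)²)^(1/2)`. It vanishes at `Q = P`, and at the
endpoint it equals the claimed distance. For `X` tangent at `Q`, the derivative of `tr ψ(H)` is
`tr(ψ'(H) K Q X)` with `K = (PQ - QP)/2` and `K Kᵀ = 1 - H²`. By Cauchy-Schwarz its square is at
most `tr((1 - H²) ψ'(H)²) tr(X²)`. If `(1 - y²) ψ'² ≤ 4ψ` on `[-1, 1]`, as holds with equality for
`ψ = arccos²` inside the interval, then `(tr ψ(H))^(1/2)` is 1-Lipschitz
(`sq_trace_aeval_derivative_mul_le`).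

The derivative of `arccos²` blows up at `-1`, so `arccos(r y)²` with `r < 1` is used first. It is
approximated in `C¹` by polynomials satisfying the same inequality
(`exists_polynomial_near_sq_arccos`), so only polynomials in matrices are ever differentiated. The
approximation error tends to `0`, then `r` to `1`. -/

/-! ### Polynomial approximation of the squared arccosine. -/

open Polynomial in
theorem exists_polynomial_derivative_eq (p : ℝ[X]) : ∃ q : ℝ[X], derivative q = p := by
  induction p using Polynomial.induction_on' with
  | add p q hp hq =>
    obtain ⟨a, rfl⟩ := hp
    obtain ⟨b, rfl⟩ := hq
    exact ⟨a + b, by simp⟩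
  | monomial n a =>
    refine ⟨monomial (n + 1) (a / (n + 1)), ?_⟩
    rw [derivative_monomial]
    congr 1
    push_cast
    field_simp

/-- `C¹` functions on an interval are approximated by polynomials together with their
derivatives. -/
theorem exists_polynomial_near_deriv {f f' : ℝ → ℝ} {a b : ℝ} (hab : a ≤ b)
    (hf : ∀ x ∈ Set.Icc a b, HasDerivAt f (f' x) x) (hf' : ContinuousOn f' (Set.Icc a b))
    {ε : ℝ} (hε : 0 < ε) :
    ∃ q : Polynomial ℝ, ∀ x ∈ Set.Icc a b,
      |q.eval x - f x| ≤ ε * (b - a) ∧ |q.derivative.eval x - f' x| ≤ ε := by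
  obtain ⟨p, hp⟩ := exists_polynomial_near_of_continuousOn a b f' hf' ε hε
  obtain ⟨q, rfl⟩ := exists_polynomial_derivative_eq p
  refine ⟨q + Polynomial.C (f a - q.eval a), fun x hx => ⟨?_, by simpa using (hp x hx).le⟩⟩
  have key := (convex_Icc a b).norm_image_sub_le_of_norm_hasDerivWithin_le
    (f := fun y => q.eval y - f y) (f' := fun y => q.derivative.eval y - f' y) (C := ε)
    (fun y hy => ((q.hasDerivAt y).sub (hf y hy)).hasDerivWithinAt)
    (fun y hy => by simpa using (hp y hy).le) (Set.left_mem_Icc.2 hab) hx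
  have h2 : |x - a| ≤ b - a := by
    rw [abs_of_nonneg (by linarith [hx.1])]; linarith [hx.2]
  simp only [Real.norm_eq_abs] at key
  calc _ = |q.eval x - f x - (q.eval a - f a)| := by simp; congr 1; ring
    _ ≤ _ := key
    _ ≤ _ := by gcongr

/-- A polynomial version of the function `y ↦ arccos (r y) ^ 2` with `r < 1`: with `y = cos x`, the
inequality says that the square root of the polynomial is `1`-Lipschitz in `x`. -/
theorem exists_polynomial_near_sq_arccos {r : ℝ} (h0 : 0 ≤ r) (h1 : r < 1) {ε : ℝ} (hε : 0 < ε) :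
    ∃ q : Polynomial ℝ, ∀ y ∈ Set.Icc (-1 : ℝ) 1, 0 < q.eval y ∧
      (1 - y ^ 2) * q.derivative.eval y ^ 2 ≤ 4 * q.eval y ∧
      |q.eval y - Real.arccos (r * y) ^ 2| ≤ ε := by
  set f' : ℝ → ℝ := fun y => 2 * Real.arccos (r * y) * (-(1 / √(1 - (r * y) ^ 2)) * r) with hf'
  have hlt : ∀ y ∈ Set.Icc (-1 : ℝ) 1, 0 < 1 - (r * y) ^ 2 := by
    intro y hy
    have : |r * y| < 1 := by
      rw [abs_mul, abs_of_nonneg h0]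
      have := abs_le.2 hy
      nlinarith [abs_nonneg y]
    have := (sq_lt_one_iff_abs_lt_one _).2 this
    linarith
  have hd : ∀ y ∈ Set.Icc (-1 : ℝ) 1, HasDerivAt (fun y => Real.arccos (r * y) ^ 2) (f' y) y := by
    intro y hy
    have hy' := hlt y hy
    have e := (Real.hasDerivAt_arccos (x := r * y) (by rintro h; rw [h] at hy'; norm_num at hy')
      (by rintro h; rw [h] at hy'; norm_num at hy')).comp y ((hasDerivAt_id y).const_mul r)
    have := e.pow 2
    simpa [hf', Function.comp_def] using! this
  have hc : ContinuousOn f' (Set.Icc (-1 : ℝ) 1) := by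
    apply ContinuousOn.mul
    · exact (by fun_prop : Continuous fun y => 2 * Real.arccos (r * y)).continuousOn
    · refine ContinuousOn.mul (ContinuousOn.neg (ContinuousOn.div continuousOn_const
        (by fun_prop) fun y hy => (Real.sqrt_pos.2 (hlt y hy)).ne')) continuousOn_const
  obtain ⟨M, hM⟩ := isCompact_Icc.exists_bound_of_continuousOn hc
  have hM0 : 0 ≤ M := (norm_nonneg _).trans (hM 0 (by simp))
  -- The total error below is at most `η (7 + 2M)`; the cap at `1` absorbs the quadratic term `η²`
  -- into `η`.
  set η := min 1 (ε / (8 + 2 * M)) with hη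
  have hη0 : 0 < η := by positivity
  have hη1 : η ≤ 1 := min_le_left _ _
  have hη2 : η * (8 + 2 * M) ≤ ε := by
    have : η ≤ ε / (8 + 2 * M) := min_le_right _ _
    rwa [le_div_iff₀ (by positivity)] at this
  obtain ⟨q, hq⟩ := exists_polynomial_near_deriv (by norm_num) hd hc hη0
  -- The upward shift pays for the approximation: `q` may lie `2η` below the target, and `q'²` may
  -- exceed `f'²` by `η (2M + 1)`. Four times the shift covers `η (9 + 2M)`.
  refine ⟨q + Polynomial.C (η * (5 + 2 * M)), fun y hy => ?_⟩
  obtain ⟨hq1, hq2⟩ := hq y hy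
  have hy' := hlt y hy
  have hM' : |f' y| ≤ M := hM y hy
  have hy2 : 0 ≤ 1 - y ^ 2 := by nlinarith [hy.1, hy.2]
  -- For the exact function the inequality reduces to `r² (1 - y²) ≤ 1 - r² y²`, that is, `r² ≤ 1`.
  have hfy : (1 - y ^ 2) * f' y ^ 2 ≤ 4 * Real.arccos (r * y) ^ 2 := by
    have : f' y ^ 2 = 4 * Real.arccos (r * y) ^ 2 * (r ^ 2 / (1 - (r * y) ^ 2)) := by
      have hs := Real.sq_sqrt hy'.le
      calc f' y ^ 2 = 4 * Real.arccos (r * y) ^ 2 * (r ^ 2 / √(1 - (r * y) ^ 2) ^ 2) := by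
            simp only [hf']; ring
        _ = _ := by rw [hs]
    rw [this, mul_left_comm]
    refine mul_le_of_le_one_right (by positivity) ?_
    rw [mul_div_assoc', div_le_one hy']
    nlinarith [mul_nonneg h0 h0]
  have hsq : q.derivative.eval y ^ 2 ≤ f' y ^ 2 + η * (2 * M + 1) := by
    have : |q.derivative.eval y| ≤ |f' y| + η := by
      have := abs_sub_abs_le_abs_sub (q.derivative.eval y) (f' y)
      linarith
    calc q.derivative.eval y ^ 2 = |q.derivative.eval y| ^ 2 := (sq_abs _).symm
      _ ≤ (|f' y| + η) ^ 2 := by gcongr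
      _ = f' y ^ 2 + η * (2 * |f' y| + η) := by rw [← sq_abs (f' y)]; ring
      _ ≤ _ := by gcongr
  have hA : 0 ≤ Real.arccos (r * y) ^ 2 := sq_nonneg _
  have hMη : 0 ≤ η * M := by positivity
  rw [abs_le] at hq1
  simp only [Polynomial.eval_add, Polynomial.eval_C, Polynomial.derivative_add,
    Polynomial.derivative_C, add_zero]
  refine ⟨by nlinarith, ?_, ?_⟩
  · have : (1 - y ^ 2) * q.derivative.eval y ^ 2 ≤
        (1 - y ^ 2) * f' y ^ 2 + η * (2 * M + 1) := by
      calc _ ≤ (1 - y ^ 2) * (f' y ^ 2 + η * (2 * M + 1)) := by gcongr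
        _ = (1 - y ^ 2) * f' y ^ 2 + (1 - y ^ 2) * (η * (2 * M + 1)) := by ring
        _ ≤ _ := add_le_add_right (mul_le_of_le_one_left (by positivity : 0 ≤ η * (2 * M + 1))
          (by nlinarith [sq_nonneg y])) _
    nlinarith
  · rw [abs_le]
    constructor <;> nlinarith

/-! ### Traces of polynomials in symmetric matrices, and the gradient bound. -/

section
open Matrix

theorem Matrix.aeval_diagonal {ι : Type*} [Fintype ι] [DecidableEq ι] (d : ι → ℝ)
    (p : Polynomial ℝ) :
    Polynomial.aeval (diagonal d) p = diagonal fun i => p.eval (d i) := by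
  rw [← Matrix.diagonalAlgHom_apply (R := ℝ), Polynomial.aeval_algHom_apply,
    Matrix.diagonalAlgHom_apply]
  congr 1
  ext i
  simp [Polynomial.aeval_def]

theorem Matrix.trace_aeval_conj_diagonal {ι : Type*} [Fintype ι] [DecidableEq ι]
    {V : Matrix ι ι ℝ} (hV : V ∈ orthogonalGroup ι ℝ) (d : ι → ℝ) (p : Polynomial ℝ) :
    (Polynomial.aeval (V * diagonal d * Vᵀ) p).trace = ∑ i, p.eval (d i) := by
  have h1 : V * diagonal d * Vᵀ = Unitary.conjStarAlgAut ℝ _ (⟨V, hV⟩ : unitary _) (diagonal d) := by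
    rw [Unitary.conjStarAlgAut_apply]; rfl
  rw [h1, ← StarAlgEquiv.coe_toAlgEquiv, ← AlgEquiv.coe_toAlgHom, Polynomial.aeval_algHom_apply,
    Matrix.aeval_diagonal]
  rw [AlgEquiv.coe_toAlgHom, StarAlgEquiv.coe_toAlgEquiv, Unitary.conjStarAlgAut_apply,
    trace_mul_cycle]
  change trace (star V * V * _) = _
  rw [Unitary.star_mul_self_of_mem hV, one_mul, trace_diagonal]

theorem Matrix.exists_orthogonal_conj_diagonal {ι : Type*} [Fintype ι] [DecidableEq ι]
    {A : Matrix ι ι ℝ} (hA : Aᵀ = A) :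
    ∃ V ∈ orthogonalGroup ι ℝ, ∃ d : ι → ℝ, A = V * diagonal d * Vᵀ := by
  have h : A.IsHermitian := by rw [IsHermitian, conjTranspose_eq_transpose_of_trivial, hA]
  refine ⟨h.eigenvectorUnitary, h.eigenvectorUnitary.2, h.eigenvalues, ?_⟩
  conv_lhs => rw [h.spectral_theorem, Unitary.conjStarAlgAut_apply]
  rfl

theorem Matrix.transpose_mul_self_of_mem {ι : Type*} [Fintype ι] [DecidableEq ι]
    {V : Matrix ι ι ℝ} (hV : V ∈ orthogonalGroup ι ℝ) : Vᵀ * V = 1 :=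
  Unitary.star_mul_self_of_mem hV

theorem Matrix.mul_transpose_self_of_mem {ι : Type*} [Fintype ι] [DecidableEq ι]
    {V : Matrix ι ι ℝ} (hV : V ∈ orthogonalGroup ι ℝ) : V * Vᵀ = 1 :=
  Unitary.mul_star_self_of_mem hV

/-- The relation with `K` forces the eigenvalues of `H` into `[-1, 1]`: in an eigenbasis its
diagonal entries read `dᵢ²` plus a sum of squares equals `1`. Polynomial inequalities on `[-1, 1]`
thus become trace inequalities. -/
theorem Matrix.trace_aeval_nonneg {ι : Type*} [Fintype ι] [DecidableEq ι]
    {H K : Matrix ι ι ℝ} (hH : Hᵀ = H) (hHK : H * H + K * Kᵀ = 1) {p : Polynomial ℝ}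
    (hp : ∀ y ∈ Set.Icc (-1 : ℝ) 1, 0 ≤ p.eval y) : 0 ≤ (Polynomial.aeval H p).trace := by
  obtain ⟨V, hV, d, rfl⟩ := exists_orthogonal_conj_diagonal hH
  rw [trace_aeval_conj_diagonal hV]
  have hV' := transpose_mul_self_of_mem hV
  refine Finset.sum_nonneg fun i _ => hp _ (abs_le.1 ((sq_le_one_iff_abs_le_one _).1 ?_))
  have h1 : diagonal d * diagonal d + (Vᵀ * K) * (Vᵀ * K)ᵀ = 1 := by
    calc _ = Vᵀ * (V * diagonal d * Vᵀ * (V * diagonal d * Vᵀ) + K * Kᵀ) * V := by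
          have e : ∀ Z, Vᵀ * (V * Z) = Z := fun Z => by rw [← mul_assoc, hV', one_mul]
          simp only [mul_add, add_mul, mul_assoc, e, hV', mul_one, transpose_mul,
            transpose_transpose]
      _ = 1 := by rw [hHK, mul_one, hV']
  have h2 := congrFun (congrFun h1 i) i
  rw [add_apply, diagonal_mul_diagonal, diagonal_apply_eq, mul_apply, one_apply_eq] at h2
  have h3 : 0 ≤ ∑ j, (Vᵀ * K) i j * (Vᵀ * K)ᵀ j i :=
    Finset.sum_nonneg fun j _ => mul_self_nonneg _
  nlinarith

/-- Cauchy-Schwarz for the Frobenius inner product. -/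
theorem Matrix.sq_trace_mul_le {ι : Type*} [Fintype ι] (A B : Matrix ι ι ℝ) :
    (A * B).trace ^ 2 ≤ (A * Aᵀ).trace * (Bᵀ * B).trace := by
  have := Finset.sum_mul_sq_le_sq_mul_sq (Finset.univ : Finset (ι × ι))
    (fun x => A x.1 x.2) (fun x => B x.2 x.1)
  simp only [← Finset.univ_product_univ, Finset.sum_product] at this
  rw [Finset.sum_comm (f := fun i j => B j i ^ 2)] at this
  rw [Finset.sum_comm (f := fun i j => B i j ^ 2)] at this
  simpa only [trace, diag, mul_apply, transpose_apply, ← sq] using this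

section
attribute [local instance] Matrix.frobeniusNormedAddCommGroup Matrix.frobeniusNormedSpace
  Matrix.frobeniusNormedRing Matrix.frobeniusNormedAlgebra

theorem HasDerivWithinAt.matrix_trace {ι : Type*} [Fintype ι] [DecidableEq ι]
    {H : ℝ → Matrix ι ι ℝ} {H' : Matrix ι ι ℝ} {s : Set ℝ} {t : ℝ}
    (h : HasDerivWithinAt H H' s t) :
    HasDerivWithinAt (fun u => (H u).trace) H'.trace s t :=
  (LinearMap.toContinuousLinearMap (traceLinearMap ι ℝ ℝ)).hasFDerivAt.comp_hasDerivWithinAt t h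

/-- Although `H` and `H'` need not commute, under the trace the terms `Hⁱ H' Hʲ` in the derivative
of a power all agree by cyclicity. -/
theorem HasDerivWithinAt.trace_aeval {ι : Type*} [Fintype ι] [DecidableEq ι]
    {H : ℝ → Matrix ι ι ℝ} {H' : Matrix ι ι ℝ} {s : Set ℝ} {t : ℝ}
    (h : HasDerivWithinAt H H' s t) (p : Polynomial ℝ) :
    HasDerivWithinAt (fun u => (Polynomial.aeval (H u) p).trace)
      (Polynomial.aeval (H t) p.derivative * H').trace s t := by
  induction p using Polynomial.induction_on' with
  | add p q hp hq => simpa [add_mul] using! hp.add hq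
  | monomial n a =>
    have := ((h.pow' n).const_smul a).matrix_trace
    simp only [Polynomial.aeval_monomial, Polynomial.derivative_monomial, ← Algebra.smul_def]
    convert! this using 1
    rw [trace_smul, trace_sum, smul_mul_assoc, trace_smul, mul_smul, smul_eq_mul, smul_eq_mul,
      smul_eq_mul]
    congr 1
    rw [Finset.sum_congr rfl (g := fun _ => (H t ^ (n - 1) * H').trace), Finset.sum_const,
      Finset.card_range, nsmul_eq_mul]
    intro i hi
    rw [trace_mul_comm, ← mul_assoc, ← pow_add, Nat.pred_eq_sub_one]
    congr 4
    have := Finset.mem_range.1 hi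
    omega
end

/-- With `H = (PQ + QP) / 2` and `X` tangent at `Q` to the space of symmetric involutions, this is
the bound on the derivative of `Q ↦ tr ψ(H)` in the direction of `X`. -/
theorem Matrix.sq_trace_aeval_derivative_mul_le {ι : Type*} [Fintype ι] [DecidableEq ι]
    {P Q X : Matrix ι ι ℝ} (hP : P * P = 1) (hPt : Pᵀ = P) (hQ : Q * Q = 1) (hQt : Qᵀ = Q)
    (hX : Q * X + X * Q = 0) (hXt : Xᵀ = X) {ψ : Polynomial ℝ}
    (hψ : ∀ y ∈ Set.Icc (-1 : ℝ) 1, 0 ≤ ψ.eval y)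
    (hψ' : ∀ y ∈ Set.Icc (-1 : ℝ) 1, (1 - y ^ 2) * ψ.derivative.eval y ^ 2 ≤ 4 * ψ.eval y) :
    0 ≤ (Polynomial.aeval ((1 / 2 : ℝ) • (P * Q + Q * P)) ψ).trace ∧
    (Polynomial.aeval ((1 / 2 : ℝ) • (P * Q + Q * P)) ψ.derivative *
      ((1 / 2 : ℝ) • (P * X + X * P))).trace ^ 2 ≤
      4 * (Polynomial.aeval ((1 / 2 : ℝ) • (P * Q + Q * P)) ψ).trace * (X * X).trace := by
  set H := (1 / 2 : ℝ) • (P * Q + Q * P) with hH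
  set K := (1 / 2 : ℝ) • (P * Q - Q * P) with hK
  set R := Polynomial.aeval H ψ.derivative with hR
  have eP : ∀ Z, P * (P * Z) = Z := fun Z => by rw [← mul_assoc, hP, one_mul]
  have eQ : ∀ Z, Q * (Q * Z) = Z := fun Z => by rw [← mul_assoc, hQ, one_mul]
  have hHt : Hᵀ = H := by
    rw [hH, transpose_smul, transpose_add, transpose_mul, transpose_mul, hPt, hQt, add_comm]
  have hHK : H * H + K * Kᵀ = 1 := by
    simp only [hH, hK, transpose_smul, transpose_sub, transpose_mul, hPt, hQt, smul_mul_smul_comm,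
      mul_add, add_mul, mul_sub, sub_mul, mul_assoc, eP, eQ, hP, hQ]
    module
  have hPR : P * R = R * P := by
    have : Commute P H := by
      simp only [Commute, SemiconjBy, hH, mul_smul_comm, smul_mul_assoc, mul_add, add_mul,
        mul_assoc, eP, hP, mul_one]
      module
    exact Polynomial.induction_on' (motive := fun p => Commute P (Polynomial.aeval H p))
      ψ.derivative (fun p q hp hq => by simpa using hp.add_right hq)
      (fun n a => by
        rw [Polynomial.aeval_monomial]
        exact (show Commute P _ from (Algebra.commutes a P).symm).mul_right (this.pow_right n))
  have hQR : Q * R = R * Q := by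
    have : Commute Q H := by
      simp only [Commute, SemiconjBy, hH, mul_smul_comm, smul_mul_assoc, mul_add, add_mul,
        mul_assoc, eQ, hQ, mul_one]
      module
    exact Polynomial.induction_on' (motive := fun p => Commute Q (Polynomial.aeval H p))
      ψ.derivative (fun p q hp hq => by simpa using hp.add_right hq)
      (fun n a => by
        rw [Polynomial.aeval_monomial]
        exact (show Commute Q _ from (Algebra.commutes a Q).symm).mul_right (this.pow_right n))
  have hRt : Rᵀ = R := by
    exact Polynomial.induction_on'
      (motive := fun p => (Polynomial.aeval H p)ᵀ = Polynomial.aeval H p)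
      ψ.derivative (fun p q hp hq => by simp [hp, hq])
      (fun n a => by
        simp only [Polynomial.aeval_monomial, ← Algebra.smul_def, transpose_smul, transpose_pow,
          hHt])
  refine ⟨trace_aeval_nonneg hHt hHK hψ, ?_⟩
  have h1 : (R * (X * P)).trace = (R * (P * X)).trace := by
    rw [← mul_assoc, trace_mul_comm, ← mul_assoc, hPR, mul_assoc]
  -- Tangency enters here: `Q X Q = -X`, after `Q` is moved around the trace past `R`.
  have h2 : (R * (Q * (P * (Q * X)))).trace = -(R * (P * X)).trace := by
    have hX' : Q * X = -(X * Q) := eq_neg_of_add_eq_zero_left hX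
    rw [← mul_assoc, ← hQR, mul_assoc, trace_mul_comm, hX']
    simp only [mul_neg, neg_mul, mul_assoc, hQ, mul_one, trace_neg]
  -- Both sides equal `tr(R P X)`. The form with `K` is what makes Cauchy-Schwarz sharp, as it
  -- produces the factor `1 - H²`.
  have h3 : (R * ((1 / 2 : ℝ) • (P * X + X * P))).trace = (R * K * Q * X).trace := by
    simp only [hK, mul_smul_comm, smul_mul_assoc, mul_add, mul_sub, sub_mul, trace_smul,
      trace_add, trace_sub, mul_assoc, eQ, h1, h2, smul_eq_mul]
    ring
  have h4 : (R * K * Q) * (R * K * Q)ᵀ =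
      Polynomial.aeval H ((1 - Polynomial.X ^ 2) * ψ.derivative ^ 2) := by
    have hKK : K * Kᵀ = 1 - H * H := eq_sub_of_add_eq' hHK
    have hHR : H * R = R * H := by
      have : Commute (Polynomial.aeval H (Polynomial.X : Polynomial ℝ)) R := by
        rw [commute_iff_eq, hR, ← map_mul, ← map_mul, mul_comm]
      simpa [commute_iff_eq] using this
    calc _ = R * (K * Kᵀ) * R := by
          simp only [transpose_mul, hRt, hQt, mul_assoc, eQ]
      _ = (1 - H * H) * R * R := by
          have : R * (1 - H * H) = (1 - H * H) * R := by
            rw [mul_sub, mul_one, ← mul_assoc, ← hHR, mul_assoc H R H, ← hHR, ← mul_assoc,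
              sub_mul, one_mul]
          rw [hKK, this]
      _ = _ := by
          simp only [map_mul, map_sub, map_one, Polynomial.aeval_X, sq, mul_assoc, ← hR]
  rw [h3]
  refine (sq_trace_mul_le _ _).trans ?_
  rw [hXt]
  refine mul_le_mul_of_nonneg_right ?_ ?_
  · rw [h4, ← sub_nonneg]
    have := trace_aeval_nonneg hHt hHK
      (p := (4 : ℝ) • ψ - (1 - Polynomial.X ^ 2) * Polynomial.derivative ψ ^ 2)
      (fun y hy => by simpa using hψ' y hy)
    rwa [map_sub, trace_sub, map_smul, trace_smul, smul_eq_mul] at this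
  · simp only [trace, diag, mul_apply]
    refine Finset.sum_nonneg fun i _ => Finset.sum_nonneg fun j _ => ?_
    rw [← hXt, transpose_apply, hXt]
    exact mul_self_nonneg _
end

/-! ### The Lipschitz bound integrated along a curve. -/

namespace InvolutionModel
open Matrix

theorem mul_self_of_mem_Gr {k n : ℕ} {Q : Matrix (Fin n) (Fin n) ℝ} (hQ : Q ∈ Gr k n) :
    Q * Q = 1 := by
  simpa [hQ.2.1] using transpose_mul_self_of_mem hQ.1

section
attribute [local instance] Matrix.frobeniusNormedAddCommGroup Matrix.frobeniusNormedSpace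
  Matrix.frobeniusNormedRing Matrix.frobeniusNormedAlgebra

variable {k n : ℕ} {P Q : Matrix (Fin n) (Fin n) ℝ} {γ : ℝ → Matrix (Fin n) (Fin n) ℝ}

theorem IsCurveFromTo.hasDerivWithinAt (h : IsCurveFromTo k P Q γ) {t : ℝ}
    (ht : t ∈ Set.Icc (0 : ℝ) 1) :
    HasDerivWithinAt γ (derivWithin γ (Set.Icc 0 1) t) (Set.Icc 0 1) t :=
  ((h.contDiffOn.differentiableOn one_ne_zero) t ht).hasDerivWithinAt

theorem IsCurveFromTo.transpose_derivWithin (h : IsCurveFromTo k P Q γ) {t : ℝ}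
    (ht : t ∈ Set.Icc (0 : ℝ) 1) :
    (derivWithin γ (Set.Icc 0 1) t)ᵀ = derivWithin γ (Set.Icc 0 1) t := by
  have h1 : HasDerivWithinAt (fun u => (γ u)ᵀ) (derivWithin γ (Set.Icc 0 1) t)ᵀ (Set.Icc 0 1) t :=
    (LinearMap.toContinuousLinearMap
      (transposeLinearEquiv (Fin n) (Fin n) ℝ ℝ).toLinearMap).hasFDerivAt.comp_hasDerivWithinAt t
      (h.hasDerivWithinAt ht)
  refine UniqueDiffWithinAt.eq_deriv _ (uniqueDiffOn_Icc one_pos t ht) h1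
    ((h.hasDerivWithinAt ht).congr (fun u hu => (h.mem u hu).2.1) (h.mem t ht).2.1)

theorem IsCurveFromTo.mul_derivWithin_add (h : IsCurveFromTo k P Q γ) {t : ℝ}
    (ht : t ∈ Set.Icc (0 : ℝ) 1) :
    γ t * derivWithin γ (Set.Icc 0 1) t + derivWithin γ (Set.Icc 0 1) t * γ t = 0 := by
  have h1 := (h.hasDerivWithinAt ht).mul (h.hasDerivWithinAt ht)
  have h2 : HasDerivWithinAt (γ * γ) 0 (Set.Icc 0 1) t :=
    (hasDerivWithinAt_const t _ (1 : Matrix (Fin n) (Fin n) ℝ)).congr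
      (fun u hu => mul_self_of_mem_Gr (h.mem u hu)) (mul_self_of_mem_Gr (h.mem t ht))
  rw [add_comm]
  exact UniqueDiffWithinAt.eq_deriv _ (uniqueDiffOn_Icc one_pos t ht) h1 h2

theorem IsCurveFromTo.continuousOn_riemannianNorm (h : IsCurveFromTo k P Q γ) :
    ContinuousOn (fun t => riemannianNorm (derivWithin γ (Set.Icc 0 1) t)) (Set.Icc 0 1) := by
  have h1 := h.contDiffOn.continuousOn_derivWithin (uniqueDiffOn_Icc one_pos) le_rfl
  have h2 : Continuous fun X : Matrix (Fin n) (Fin n) ℝ => riemannianNorm X := by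
    unfold riemannianNorm metric
    exact Real.continuous_sqrt.comp (continuous_id.matrix_mul continuous_id).matrix_trace
  exact h2.comp_continuousOn h1

/-- By the gradient bound, the square root of `tr ψ(H) + δ` grows along `γ` no faster than arc
length; `δ` keeps the root differentiable where the trace vanishes. -/
theorem IsCurveFromTo.sqrt_trace_aeval_le (h : IsCurveFromTo k P Q γ) {ψ : Polynomial ℝ}
    (hψ : ∀ y ∈ Set.Icc (-1 : ℝ) 1, 0 ≤ ψ.eval y)
    (hψ' : ∀ y ∈ Set.Icc (-1 : ℝ) 1, (1 - y ^ 2) * ψ.derivative.eval y ^ 2 ≤ 4 * ψ.eval y)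
    {δ : ℝ} (hδ : 0 < δ) :
    √((Polynomial.aeval ((1 / 2 : ℝ) • (P * Q + Q * P)) ψ).trace + δ) ≤
      √(n * ψ.eval 1 + δ) + curveLength γ := by
  have hP : P ∈ Gr k n := h.source ▸ h.mem 0 (by simp)
  have hPP := mul_self_of_mem_Gr hP
  set H : ℝ → Matrix (Fin n) (Fin n) ℝ := fun t => (1 / 2 : ℝ) • (P * γ t + γ t * P) with hH
  set f : ℝ → ℝ := fun t => (Polynomial.aeval (H t) ψ).trace with hf
  have hf1 : f 1 = (Polynomial.aeval ((1 / 2 : ℝ) • (P * Q + Q * P)) ψ).trace := by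
    simp only [hf, hH, h.target]
  -- At the start `γ 0 = P`, hence `H = P² = 1`.
  have hf0 : f 0 = n * ψ.eval 1 := by
    have : H 0 = 1 * diagonal (fun _ => 1) * 1ᵀ := by
      simp only [hH, h.source, hPP, transpose_one, diagonal_one, mul_one]
      module
    simp only [hf, this]
    rw [trace_aeval_conj_diagonal (one_mem _)]
    simp
  have key := fun t (ht : t ∈ Set.Icc (0 : ℝ) 1) =>
    sq_trace_aeval_derivative_mul_le hPP hP.2.1 (mul_self_of_mem_Gr (h.mem t ht))
      (h.mem t ht).2.1 (h.mul_derivWithin_add ht) (h.transpose_derivWithin ht) hψ hψ'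
  have hd : ∀ t ∈ Set.Icc (0 : ℝ) 1, HasDerivWithinAt f
      (Polynomial.aeval (H t) ψ.derivative * ((1 / 2 : ℝ) • (P * derivWithin γ (Set.Icc 0 1) t +
        derivWithin γ (Set.Icc 0 1) t * P))).trace (Set.Icc 0 1) t := by
    intro t ht
    have h1 := h.hasDerivWithinAt ht
    exact HasDerivWithinAt.trace_aeval
      (((h1.const_mul P).add (h1.mul_const P)).const_smul (1 / 2 : ℝ)) ψ
  have hs : ∀ t ∈ Set.Icc (0 : ℝ) 1, HasDerivWithinAt (fun t => √(f t + δ)) _ (Set.Icc 0 1) t :=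
    fun t ht => ((hd t ht).add_const δ).sqrt (by have : 0 ≤ f t := (key t ht).1; positivity)
  have := intervalIntegral.sub_le_integral_of_hasDeriv_right_of_le
    (φ := fun t => riemannianNorm (derivWithin γ (Set.Icc 0 1) t)) zero_le_one
    (fun t ht => (hs t ht).continuousWithinAt)
    (fun t ht => ((hs t (Set.Ioo_subset_Icc_self ht)).hasDerivAt
      (Icc_mem_nhds ht.1 ht.2)).hasDerivWithinAt)
    h.continuousOn_riemannianNorm.integrableOn_Icc ?_
  · rw [← hf1, ← hf0, curveLength]
    linarith
  · intro t ht
    obtain ⟨h0, h1⟩ := key t (Set.Ioo_subset_Icc_self ht)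
    change 0 ≤ f t at h0
    rw [div_le_iff₀ (by positivity)]
    refine (Real.le_sqrt_of_sq_le h1).trans ?_
    change √(4 * f t * metric _ _) ≤ riemannianNorm _ * _
    rw [Real.sqrt_mul (by positivity), mul_comm, ← riemannianNorm]
    refine mul_le_mul_of_nonneg_left ?_ (Real.sqrt_nonneg _)
    rw [Real.sqrt_mul zero_le_four, show (4 : ℝ) = 2 ^ 2 by norm_num, Real.sqrt_sq zero_le_two]
    gcongr
    linarith
end
end InvolutionModel

/-! ### Passage to the limit, giving the lower bound for lengths. -/

namespace InvolutionModel
open Matrix Filter Topology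

/-- The approximation error is removed for fixed `r`. The term in `arccos r` is the value at the
starting point, which disappears only as `r → 1`. -/
theorem IsCurveFromTo.sqrt_sum_sq_arccos_mul_le {k n : ℕ} {P Q V : Matrix (Fin n) (Fin n) ℝ}
    {γ : ℝ → Matrix (Fin n) (Fin n) ℝ} (h : IsCurveFromTo k P Q γ)
    (hV : V ∈ orthogonalGroup (Fin n) ℝ) {d : Fin n → ℝ} (hd : ∀ i, d i ∈ Set.Icc (-1 : ℝ) 1)
    (hPQ : (1 / 2 : ℝ) • (P * Q + Q * P) = V * diagonal d * Vᵀ) {r : ℝ} (h0 : 0 ≤ r)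
    (h1 : r < 1) :
    √(∑ i, Real.arccos (r * d i) ^ 2) ≤ √(n * Real.arccos r ^ 2) + curveLength γ := by
  have key : ∀ ε > 0, √(∑ i, (Real.arccos (r * d i) ^ 2 - ε)) ≤
      √(n * (Real.arccos r ^ 2 + ε) + ε) + curveLength γ := by
    intro ε hε
    obtain ⟨ψ, hψ⟩ := exists_polynomial_near_sq_arccos h0 h1 hε
    have := h.sqrt_trace_aeval_le (fun y hy => (hψ y hy).1.le) (fun y hy => (hψ y hy).2.1) hε
    rw [hPQ, trace_aeval_conj_diagonal hV] at this
    refine (Real.sqrt_le_sqrt ?_).trans (this.trans ?_)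
    · refine (Finset.sum_le_sum fun i _ => ?_).trans (le_add_of_nonneg_right hε.le)
      linarith [(abs_le.1 (hψ _ (hd i)).2.2).1]
    · gcongr
      have := (abs_le.1 (hψ 1 (by norm_num)).2.2).2
      rw [mul_one] at this
      linarith
  have l1 : Tendsto (fun ε : ℝ => √(∑ i, (Real.arccos (r * d i) ^ 2 - ε))) (𝓝[>] 0)
      (𝓝 √(∑ i, (Real.arccos (r * d i) ^ 2 - 0))) :=
    (Continuous.tendsto (by fun_prop) 0).mono_left nhdsWithin_le_nhds
  have l2 : Tendsto (fun ε : ℝ => √(n * (Real.arccos r ^ 2 + ε) + ε) + curveLength γ) (𝓝[>] 0)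
      (𝓝 (√(n * (Real.arccos r ^ 2 + 0) + 0) + curveLength γ)) :=
    (Continuous.tendsto (by fun_prop) 0).mono_left nhdsWithin_le_nhds
  simpa using le_of_tendsto_of_tendsto l1 l2 (eventually_mem_nhdsWithin.mono key)

/-- The length of a curve from `P` to `Q` is bounded below by the norm of the vector of the
arguments of the eigenvalues of the orthogonal matrix `PQ`. -/
theorem IsCurveFromTo.sqrt_sum_sq_arccos_le {k n : ℕ} {P Q V : Matrix (Fin n) (Fin n) ℝ}
    {γ : ℝ → Matrix (Fin n) (Fin n) ℝ} (h : IsCurveFromTo k P Q γ)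
    (hV : V ∈ orthogonalGroup (Fin n) ℝ) {d : Fin n → ℝ} (hd : ∀ i, d i ∈ Set.Icc (-1 : ℝ) 1)
    (hPQ : (1 / 2 : ℝ) • (P * Q + Q * P) = V * diagonal d * Vᵀ) :
    √(∑ i, Real.arccos (d i) ^ 2) ≤ curveLength γ := by
  have l1 : Tendsto (fun r : ℝ => √(∑ i, Real.arccos (r * d i) ^ 2)) (𝓝[<] 1)
      (𝓝 √(∑ i, Real.arccos (1 * d i) ^ 2)) :=
    (Continuous.tendsto (by fun_prop) 1).mono_left nhdsWithin_le_nhds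
  have l2 : Tendsto (fun r : ℝ => √(n * Real.arccos r ^ 2) + curveLength γ) (𝓝[<] 1)
      (𝓝 (√(n * Real.arccos 1 ^ 2) + curveLength γ)) :=
    (Continuous.tendsto (by fun_prop) 1).mono_left nhdsWithin_le_nhds
  have := le_of_tendsto_of_tendsto l1 l2 (by
    filter_upwards [Ioo_mem_nhdsLT (zero_lt_one' ℝ)] with r hr using
      h.sqrt_sum_sq_arccos_mul_le hV hd hPQ hr.1.le hr.2)
  simpa using this

/-! ### Algebra of block and rectangular diagonal matrices. -/

section Blocks

variable {k m n : ℕ} {h : k + m = n}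

theorem blockMatrix_mul (A A' : Matrix (Fin k) (Fin k) ℝ) (B B' : Matrix (Fin k) (Fin m) ℝ)
    (C C' : Matrix (Fin m) (Fin k) ℝ) (D D' : Matrix (Fin m) (Fin m) ℝ) :
    blockMatrix h A B C D * blockMatrix h A' B' C' D' =
      blockMatrix h (A * A' + B * C') (A * B' + B * D') (C * A' + D * C') (C * B' + D * D') := by
  simp only [blockMatrix, reindex_apply, submatrix_mul_equiv, fromBlocks_multiply]

theorem blockMatrix_transpose (A : Matrix (Fin k) (Fin k) ℝ) (B : Matrix (Fin k) (Fin m) ℝ)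
    (C : Matrix (Fin m) (Fin k) ℝ) (D : Matrix (Fin m) (Fin m) ℝ) :
    (blockMatrix h A B C D)ᵀ = blockMatrix h Aᵀ Cᵀ Bᵀ Dᵀ := by
  simp only [blockMatrix, reindex_apply, transpose_submatrix, fromBlocks_transpose]

theorem blockMatrix_add (A A' : Matrix (Fin k) (Fin k) ℝ) (B B' : Matrix (Fin k) (Fin m) ℝ)
    (C C' : Matrix (Fin m) (Fin k) ℝ) (D D' : Matrix (Fin m) (Fin m) ℝ) :
    blockMatrix h A B C D + blockMatrix h A' B' C' D' =
      blockMatrix h (A + A') (B + B') (C + C') (D + D') := by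
  simp only [blockMatrix, reindex_apply, ← fromBlocks_add, submatrix_add, Pi.add_apply]

theorem blockMatrix_smul (a : ℝ) (A : Matrix (Fin k) (Fin k) ℝ) (B : Matrix (Fin k) (Fin m) ℝ)
    (C : Matrix (Fin m) (Fin k) ℝ) (D : Matrix (Fin m) (Fin m) ℝ) :
    a • blockMatrix h A B C D = blockMatrix h (a • A) (a • B) (a • C) (a • D) := by
  simp only [blockMatrix, reindex_apply, ← fromBlocks_smul, submatrix_smul, Pi.smul_apply]

theorem blockMatrix_one : blockMatrix h 1 0 0 1 = 1 := by
  simp only [blockMatrix, reindex_apply, fromBlocks_one, submatrix_one_equiv]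

theorem blockMatrix_trace (A : Matrix (Fin k) (Fin k) ℝ) (B : Matrix (Fin k) (Fin m) ℝ)
    (C : Matrix (Fin m) (Fin k) ℝ) (D : Matrix (Fin m) (Fin m) ℝ) :
    (blockMatrix h A B C D).trace = A.trace + D.trace := by
  rw [blockMatrix, reindex_apply]
  refine (Equiv.sum_comp (finSumFinEquiv.trans (finCongr h)).symm
    fun i => fromBlocks A B C D i i).trans ?_
  rw [Fintype.sum_sum_type]
  rfl

theorem blockMatrix_inj {A A' : Matrix (Fin k) (Fin k) ℝ} {B B' : Matrix (Fin k) (Fin m) ℝ}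
    {C C' : Matrix (Fin m) (Fin k) ℝ} {D D' : Matrix (Fin m) (Fin m) ℝ} :
    blockMatrix h A B C D = blockMatrix h A' B' C' D' ↔ A = A' ∧ B = B' ∧ C = C' ∧ D = D' := by
  rw [blockMatrix, blockMatrix, EmbeddingLike.apply_eq_iff_eq, fromBlocks_inj]

theorem exists_eq_blockMatrix (h : k + m = n) (M : Matrix (Fin n) (Fin n) ℝ) :
    ∃ A B C D, M = blockMatrix h A B C D := by
  let e := finSumFinEquiv.trans (finCongr h)
  let N := (reindex e e).symm M
  refine ⟨N.toBlocks₁₁, N.toBlocks₁₂, N.toBlocks₂₁, N.toBlocks₂₂, ?_⟩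
  rw [blockMatrix, fromBlocks_toBlocks]
  exact ((reindex e e).apply_symm_apply M).symm

theorem blockMatrix_diagonal (a : Fin k → ℝ) (b : Fin m → ℝ) :
    blockMatrix h (diagonal a) 0 0 (diagonal b) =
      diagonal (Sum.elim a b ∘ (finSumFinEquiv.trans (finCongr h)).symm) := by
  rw [blockMatrix, fromBlocks_diagonal, reindex_apply, submatrix_diagonal_equiv]

theorem sum_sumElim_comp (a : Fin k → ℝ) (b : Fin m → ℝ) (f : ℝ → ℝ) :
    ∑ i, f ((Sum.elim a b ∘ (finSumFinEquiv.trans (finCongr h)).symm) i) =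
      ∑ i, f (a i) + ∑ i, f (b i) := by
  refine (Equiv.sum_comp (finSumFinEquiv.trans (finCongr h)).symm
    fun i => f (Sum.elim a b i)).trans ?_
  rw [Fintype.sum_sum_type]
  rfl

theorem mem_orthogonalGroup_of_mul_transpose {ι : Type*} [Fintype ι] [DecidableEq ι]
    {V : Matrix ι ι ℝ} (hV : V * Vᵀ = 1) : V ∈ orthogonalGroup ι ℝ :=
  (mem_orthogonalGroup_iff _ _).2 hV

theorem transpose_mem_orthogonalGroup {ι : Type*} [Fintype ι] [DecidableEq ι]
    {V : Matrix ι ι ℝ} (hV : V ∈ orthogonalGroup ι ℝ) : Vᵀ ∈ orthogonalGroup ι ℝ :=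
  mem_orthogonalGroup_of_mul_transpose (by
    rw [transpose_transpose, transpose_mul_self_of_mem hV])

theorem blockMatrix_mem_orthogonalGroup {U : Matrix (Fin k) (Fin k) ℝ}
    {V : Matrix (Fin m) (Fin m) ℝ} (hU : U ∈ orthogonalGroup (Fin k) ℝ)
    (hV : V ∈ orthogonalGroup (Fin m) ℝ) :
    blockMatrix h U 0 0 V ∈ orthogonalGroup (Fin n) ℝ := by
  apply mem_orthogonalGroup_of_mul_transpose
  simp [blockMatrix_transpose, blockMatrix_mul, mul_transpose_self_of_mem hU,
    mul_transpose_self_of_mem hV, blockMatrix_one]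

theorem blockMatrix_mul_signature (U : Matrix (Fin k) (Fin k) ℝ) (V : Matrix (Fin m) (Fin m) ℝ) :
    blockMatrix h U 0 0 V * signature h = signature h * blockMatrix h U 0 0 V := by
  simp [signature, blockMatrix_mul]

/-- The matrix `diag(v₁, …, v_k, 0, …, 0)` of size `m`, for `k ≤ m`. -/
def zeroPaddedDiag {k : ℕ} (m : ℕ) (v : Fin k → ℝ) : Matrix (Fin m) (Fin m) ℝ :=
  Matrix.diagonal fun j => if h : (j : ℕ) < k then v ⟨j, h⟩ else 0

theorem diagonal_mul_rectDiag (v w : Fin k → ℝ) :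
    diagonal v * rectDiag m w = rectDiag m (v * w) := by
  ext i j
  simp [rectDiag, diagonal_mul]

theorem rectDiag_mul_paddedDiag (v w : Fin k → ℝ) :
    rectDiag m v * paddedDiag m w = rectDiag m (v * w) := by
  ext i j
  rw [paddedDiag, mul_diagonal]
  simp only [rectDiag, of_apply]
  by_cases hij : (i : ℕ) = j
  · simp [← hij]
  · simp [hij]

theorem rectDiag_mul_transpose (hkm : k ≤ m) (v w : Fin k → ℝ) :
    rectDiag m v * (rectDiag m w)ᵀ = diagonal (v * w) := by
  ext i j
  rw [mul_apply, Finset.sum_eq_single (Fin.castLE hkm i)]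
  · by_cases hij : i = j
    · simp [rectDiag, hij]
    · simp [rectDiag, diagonal_apply_ne _ hij, Fin.ext_iff.not.1 (Ne.symm hij)]
  · intro l _ hl
    have : ¬ (i : ℕ) = l := fun e => hl (Fin.ext e.symm)
    simp [rectDiag, this]
  · simp

theorem transpose_rectDiag_mul (v w : Fin k → ℝ) :
    (rectDiag m v)ᵀ * rectDiag m w = zeroPaddedDiag m (v * w) := by
  ext i j
  rw [mul_apply]
  by_cases hi : (i : ℕ) < k
  · rw [Finset.sum_eq_single ⟨i, hi⟩]
    · by_cases hij : i = j
      · simp [rectDiag, zeroPaddedDiag, hij, hij ▸ hi]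
      · simp [rectDiag, zeroPaddedDiag, hij, Fin.ext_iff.not.1 hij]
    · intro l _ hl
      have : ¬ (l : ℕ) = i := fun e => hl (Fin.ext e)
      simp [rectDiag, this]
    · simp
  · rw [Finset.sum_eq_zero]
    · by_cases hij : i = j
      · simp [zeroPaddedDiag, hij, hij ▸ hi]
      · simp [zeroPaddedDiag, hij]
    · intro l _
      have : ¬ (l : ℕ) = i := fun e => hi (e ▸ l.2)
      simp [rectDiag, this]

theorem sum_dite_lt (hkm : k ≤ m) (f : Fin k → ℝ) :
    ∑ j : Fin m, (if h : (j : ℕ) < k then f ⟨j, h⟩ else 0) = ∑ i, f i := by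
  obtain ⟨l, rfl⟩ := Nat.exists_eq_add_of_le hkm
  rw [Fin.sum_univ_add]
  simp

end Blocks
end InvolutionModel

/-! ### The explicit geodesic and its velocity. -/

namespace InvolutionModel
open Matrix

section Geodesic

variable {k m n : ℕ} {h : k + m = n}

/-- The involution `[cos Φ, -sin Φ, 0; -sin Φ, -cos Φ, 0; 0, 0, -I]`, which is the image of the
signature matrix under the rotation with angles `φᵢ / 2`. -/
noncomputable def geodesicPoint (h : k + m = n) (φ : Fin k → ℝ) : Matrix (Fin n) (Fin n) ℝ :=
  blockMatrix h
    (diagonal fun i => Real.cos (φ i))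
    (-(rectDiag m fun i => Real.sin (φ i)))
    (-(rectDiag m fun i => Real.sin (φ i))ᵀ)
    (-(paddedDiag m fun i => Real.cos (φ i)))

/-- The derivative of `t ↦ geodesicPoint h (t • φ)`. -/
noncomputable def geodesicVelocity (h : k + m = n) (φ : Fin k → ℝ) (t : ℝ) :
    Matrix (Fin n) (Fin n) ℝ :=
  blockMatrix h
    (diagonal fun i => -(φ i * Real.sin (t * φ i)))
    (-(rectDiag m fun i => φ i * Real.cos (t * φ i)))
    (-(rectDiag m fun i => φ i * Real.cos (t * φ i))ᵀ)
    (zeroPaddedDiag m fun i => φ i * Real.sin (t * φ i))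

theorem csMiddle_mul_transpose (hkm : k ≤ m) (θ : Fin k → ℝ) :
    csMiddle h θ * (csMiddle h θ)ᵀ = 1 := by
  rw [csMiddle, blockMatrix_transpose, blockMatrix_mul, ← blockMatrix_one (h := h),
    blockMatrix_inj]
  have e1 : diagonal (fun i => Real.cos (θ i)) * rectDiag m (fun i => Real.sin (θ i)) =
      rectDiag m (fun i => Real.sin (θ i)) * paddedDiag m (fun i => Real.cos (θ i)) := by
    rw [diagonal_mul_rectDiag, rectDiag_mul_paddedDiag, mul_comm]
  have hp : ∀ v : Fin k → ℝ, (paddedDiag m v)ᵀ = paddedDiag m v := fun v => diagonal_transpose _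
  refine ⟨?_, ?_, ?_, ?_⟩
  · rw [diagonal_transpose, diagonal_mul_diagonal, rectDiag_mul_transpose hkm, diagonal_add,
      ← diagonal_one]
    congr 1
    ext i
    simp [← sq]
  · rw [transpose_neg, transpose_transpose, Matrix.mul_neg, e1, hp, neg_add_cancel]
  · rw [diagonal_transpose, Matrix.neg_mul, ← diagonal_transpose, ← transpose_mul, e1, transpose_mul,
      hp, neg_add_cancel]
  · rw [transpose_neg, transpose_transpose, Matrix.neg_mul, Matrix.mul_neg, neg_neg,
      transpose_rectDiag_mul, hp,
      zeroPaddedDiag, paddedDiag, diagonal_mul_diagonal, diagonal_add, ← diagonal_one]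
    congr 1
    ext j
    split_ifs <;> simp [← sq]

/-- The double-angle formulas: conjugating a reflection by a rotation doubles the angle. -/
theorem csMiddle_mul_signature_mul_transpose (hkm : k ≤ m) (θ : Fin k → ℝ) :
    csMiddle h θ * signature h * (csMiddle h θ)ᵀ = geodesicPoint h fun i => 2 * θ i := by
  rw [csMiddle, signature, blockMatrix_transpose, blockMatrix_mul, blockMatrix_mul, geodesicPoint,
    blockMatrix_inj]
  have e1 : diagonal (fun i => Real.cos (θ i)) * rectDiag m (fun i => Real.sin (θ i)) =
      rectDiag m (fun i => Real.sin (θ i)) * paddedDiag m (fun i => Real.cos (θ i)) := by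
    rw [diagonal_mul_rectDiag, rectDiag_mul_paddedDiag, mul_comm]
  have e2 : diagonal (fun i => Real.cos (θ i)) * rectDiag m (fun i => Real.sin (θ i)) +
      diagonal (fun i => Real.cos (θ i)) * rectDiag m (fun i => Real.sin (θ i)) =
      rectDiag m (fun i => Real.sin (2 * θ i)) := by
    rw [diagonal_mul_rectDiag]
    ext i j
    simp only [rectDiag, Matrix.add_apply, of_apply, Pi.mul_apply, Real.sin_two_mul]
    split_ifs <;> ring
  have hp : ∀ v : Fin k → ℝ, (paddedDiag m v)ᵀ = paddedDiag m v := fun v => diagonal_transpose _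
  simp only [Matrix.mul_one, Matrix.mul_zero, add_zero, zero_add, Matrix.mul_neg, Matrix.neg_mul,
    transpose_neg,
    transpose_transpose, diagonal_transpose, hp]
  refine ⟨?_, ?_, ?_, ?_⟩
  · rw [diagonal_mul_diagonal, rectDiag_mul_transpose hkm, ← sub_eq_add_neg, diagonal_sub]
    congr 1
    ext i
    simp [← sq, Real.cos_two_mul']
  · rw [← e1, ← e2]; abel
  · rw [← e2, transpose_add]
    have e3 := congrArg transpose e1
    simp only [transpose_mul, diagonal_transpose, hp] at e3 ⊢
    rw [← e3]
    abel
  · rw [neg_neg, transpose_rectDiag_mul,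
      zeroPaddedDiag, paddedDiag, diagonal_mul_diagonal, ← sub_eq_add_neg, diagonal_sub, paddedDiag,
      diagonal_neg]
    congr 1
    ext j
    split_ifs <;> simp [← sq, Real.cos_two_mul']

theorem geodesicPoint_zero : geodesicPoint h (fun _ => 0) = signature h := by
  rw [geodesicPoint, signature, blockMatrix_inj]
  refine ⟨by simp, ?_, ?_, ?_⟩
  · ext i j; simp [rectDiag]
  · ext i j; simp [rectDiag]
  · simp [paddedDiag]

/-- The off-diagonal blocks cancel, so the matrix `H` of the lower bound is already diagonal, with
each `cos φᵢ` occurring twice when `k ≤ m`. -/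
theorem signature_anticommutator_geodesicPoint (φ : Fin k → ℝ) :
    (1 / 2 : ℝ) • (signature h * geodesicPoint h φ + geodesicPoint h φ * signature h) =
      blockMatrix h (diagonal fun i => Real.cos (φ i)) 0 0
        (paddedDiag m fun i => Real.cos (φ i)) := by
  rw [signature, geodesicPoint, blockMatrix_mul, blockMatrix_mul, blockMatrix_add,
    blockMatrix_smul, blockMatrix_inj]
  simp only [Matrix.mul_one, Matrix.mul_zero, add_zero, zero_add, Matrix.mul_neg, Matrix.neg_mul,
    Matrix.one_mul, Matrix.zero_mul, neg_neg, neg_zero]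
  refine ⟨?_, ?_, ?_, ?_⟩ <;> module

/-- By `sin² + cos² = 1` each angle contributes `φᵢ²` once in each diagonal block, so the speed is
constant in `t`. -/
theorem metric_geodesicVelocity (hkm : k ≤ m) (φ : Fin k → ℝ) (t : ℝ) :
    metric (geodesicVelocity h φ t) (geodesicVelocity h φ t) = 2 * ∑ i, φ i ^ 2 := by
  rw [metric, geodesicVelocity, blockMatrix_mul, blockMatrix_trace]
  rw [Matrix.neg_mul, Matrix.mul_neg, Matrix.neg_mul, Matrix.mul_neg, neg_neg, neg_neg,
    rectDiag_mul_transpose hkm, transpose_rectDiag_mul, zeroPaddedDiag,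
    zeroPaddedDiag, diagonal_mul_diagonal, diagonal_mul_diagonal, diagonal_add, diagonal_add,
    trace_diagonal, trace_diagonal]
  have := sum_dite_lt hkm fun i => φ i * Real.cos (t * φ i) * (φ i * Real.cos (t * φ i)) +
    φ i * Real.sin (t * φ i) * (φ i * Real.sin (t * φ i))
  rw [Finset.sum_congr rfl (g := fun j : Fin m => if h : (j : ℕ) < k then _ else 0)
    (fun j _ => ?_), this, ← Finset.sum_add_distrib, Finset.mul_sum]
  · refine Finset.sum_congr rfl fun i _ => ?_
    simp only [Pi.mul_apply]
    linear_combination 2 * φ i ^ 2 * Real.sin_sq_add_cos_sq (t * φ i)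
  · simp only [Pi.mul_apply]
    split_ifs <;> simp

theorem hasDerivAt_matrix {p q : Type*} [Fintype p] [Fintype q] {f : ℝ → Matrix p q ℝ}
    {f' : Matrix p q ℝ} {t : ℝ} :
    HasDerivAt f f' t ↔ ∀ i j, HasDerivAt (fun u => f u i j) (f' i j) t := by
  refine (hasDerivAt_pi (φ := f) (φ' := f')).trans (forall_congr' fun i => ?_)
  exact hasDerivAt_pi

theorem hasDerivAt_geodesicPoint (φ : Fin k → ℝ) (t : ℝ) :
    HasDerivAt (fun u => geodesicPoint h fun i => u * φ i) (geodesicVelocity h φ t) t := by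
  rw [hasDerivAt_matrix]
  intro i j
  have hc : ∀ i, HasDerivAt (fun u => Real.cos (u * φ i)) (-(φ i * Real.sin (t * φ i))) t := by
    intro i
    convert! ((hasDerivAt_id t).mul_const (φ i)).cos using 1
    simp [mul_comm]
  have hs : ∀ i, HasDerivAt (fun u => Real.sin (u * φ i)) (φ i * Real.cos (t * φ i)) t := by
    intro i
    convert! ((hasDerivAt_id t).mul_const (φ i)).sin using 1
    simp [mul_comm]
  simp only [geodesicPoint, geodesicVelocity, blockMatrix, reindex_apply, submatrix_apply]
  generalize (finSumFinEquiv.trans (finCongr h)).symm i = a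
  generalize (finSumFinEquiv.trans (finCongr h)).symm j = b
  rcases a with a | a <;> rcases b with b | b
  · by_cases hab : a = b
    · simpa [hab] using hc b
    · simpa [hab] using hasDerivAt_const t (0 : ℝ)
  · by_cases hab : (a : ℕ) = b
    · simpa [rectDiag, hab] using! (hs a).neg
    · simpa [rectDiag, hab] using hasDerivAt_const t (0 : ℝ)
  · by_cases hab : (b : ℕ) = a
    · simpa [rectDiag, hab] using! (hs b).neg
    · simpa [rectDiag, hab] using hasDerivAt_const t (0 : ℝ)
  · by_cases hab : a = b
    · subst hab
      by_cases ha : (a : ℕ) < k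
      · simpa [paddedDiag, zeroPaddedDiag, ha] using! (hc ⟨a, ha⟩).neg
      · simpa [paddedDiag, zeroPaddedDiag, ha] using hasDerivAt_const t (-1 : ℝ)
    · simpa [paddedDiag, zeroPaddedDiag, hab] using hasDerivAt_const t (0 : ℝ)

theorem continuous_geodesicVelocity (φ : Fin k → ℝ) : Continuous (geodesicVelocity h φ) := by
  refine continuous_matrix fun i j => ?_
  simp only [geodesicVelocity, blockMatrix, reindex_apply, submatrix_apply]
  generalize (finSumFinEquiv.trans (finCongr h)).symm i = a
  generalize (finSumFinEquiv.trans (finCongr h)).symm j = b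
  rcases a with a | a <;> rcases b with b | b <;>
    simp only [fromBlocks_apply₁₁, fromBlocks_apply₁₂, fromBlocks_apply₂₁, fromBlocks_apply₂₂,
      rectDiag, zeroPaddedDiag, diagonal_apply, Matrix.neg_apply, transpose_apply, of_apply] <;>
    split_ifs <;> first | exact continuous_const | fun_prop

end Geodesic

/-! ### Length of the geodesic and the value of the distance. -/

section
attribute [local instance] Matrix.frobeniusNormedAddCommGroup Matrix.frobeniusNormedSpace
  Matrix.frobeniusNormedRing Matrix.frobeniusNormedAlgebra

variable {k m n : ℕ} {h : k + m = n}

theorem isCurveFromTo_geodesicPoint (hkm : k ≤ m) {A : Matrix (Fin n) (Fin n) ℝ}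
    (hA : A ∈ orthogonalGroup (Fin n) ℝ) (θ : Fin k → ℝ) :
    IsCurveFromTo k (A * signature h * Aᵀ) (A * geodesicPoint h (fun i => 2 * θ i) * Aᵀ)
      (fun t => A * geodesicPoint h (fun i => t * (2 * θ i)) * Aᵀ) ∧
    curveLength (fun t => A * geodesicPoint h (fun i => t * (2 * θ i)) * Aᵀ) =
      2 * √2 * √(∑ i, θ i ^ 2) := by
  have hd : ∀ t, HasDerivAt (fun t => A * geodesicPoint h (fun i => t * (2 * θ i)) * Aᵀ)
      (A * geodesicVelocity h (fun i => 2 * θ i) t * Aᵀ) t := fun t =>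
    ((hasDerivAt_geodesicPoint (fun i => 2 * θ i) t).const_mul A).mul_const Aᵀ
  constructor
  · refine ⟨?_, ?_, ?_, ?_⟩
    · refine (contDiff_one_iff_deriv.2 ⟨fun t => (hd t).differentiableAt, ?_⟩).contDiffOn
      rw [funext fun t => (hd t).deriv]
      exact (continuous_const.matrix_mul (continuous_geodesicVelocity _)).matrix_mul
        continuous_const
    · intro t _
      -- Written this way, the point at time `t` is the signature conjugated by `A` times the
      -- rotation with angles `t θᵢ`, which shows that it lies in `Gr k n`.
      have e : (fun i => t * (2 * θ i)) = fun i => 2 * (t * θ i) := by ext i; ring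
      simp only [e]
      rw [← csMiddle_mul_signature_mul_transpose hkm]
      set V := A * csMiddle h (fun i => t * θ i) with hV
      have hVm : V ∈ orthogonalGroup (Fin n) ℝ :=
        mul_mem hA (mem_orthogonalGroup_of_mul_transpose (csMiddle_mul_transpose hkm _))
      have hs : (signature h)ᵀ = signature h := by simp [signature, blockMatrix_transpose]
      have hs2 : signature h * signature h = 1 := by
        simp [signature, blockMatrix_mul, blockMatrix_one]
      have e2 : A * (csMiddle h (fun i => t * θ i) * signature h *
          (csMiddle h (fun i => t * θ i))ᵀ) * Aᵀ = V * signature h * Vᵀ := by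
        simp only [hV, transpose_mul, mul_assoc]
      rw [e2]
      refine ⟨?_, ?_, ?_⟩
      · exact mul_mem (mul_mem hVm (mem_orthogonalGroup_of_mul_transpose (by rw [hs, hs2])))
          (transpose_mem_orthogonalGroup hVm)
      · simp only [transpose_mul, transpose_transpose, hs, mul_assoc]
      · rw [trace_mul_cycle, transpose_mul_self_of_mem hVm, one_mul, signature, blockMatrix_trace]
        subst h
        simp
        ring
    · simp only [zero_mul, geodesicPoint_zero]
    · simp only [one_mul]
  · rw [curveLength, intervalIntegral.integral_congr
      (g := fun _ => 2 * √2 * √(∑ i, θ i ^ 2)), intervalIntegral.integral_const]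
    · simp
    · intro t ht
      rw [Set.uIcc_of_le zero_le_one] at ht
      simp only
      refine (congrArg riemannianNorm
        ((hd t).hasDerivWithinAt.derivWithin (uniqueDiffOn_Icc one_pos t ht))).trans ?_
      have e : metric (A * geodesicVelocity h (fun i => 2 * θ i) t * Aᵀ)
          (A * geodesicVelocity h (fun i => 2 * θ i) t * Aᵀ) =
          metric (geodesicVelocity h (fun i => 2 * θ i) t)
            (geodesicVelocity h (fun i => 2 * θ i) t) := by
        have : ∀ Z, Aᵀ * (A * Z) = Z := fun Z => by
          rw [← mul_assoc, transpose_mul_self_of_mem hA, one_mul]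
        simp only [metric, mul_assoc, this]
        rw [trace_mul_comm]
        simp only [mul_assoc, transpose_mul_self_of_mem hA, mul_one]
      rw [riemannianNorm, e, metric_geodesicVelocity hkm]
      simp only [mul_pow]
      rw [← Finset.mul_sum, show 2 * (2 ^ 2 * ∑ i, θ i ^ 2) = 2 ^ 2 * (2 * ∑ i, θ i ^ 2) by ring,
        Real.sqrt_mul (by norm_num), Real.sqrt_sq zero_le_two, Real.sqrt_mul zero_le_two, mul_assoc]

theorem geodesicDist_eq (hkm : k ≤ m) {A : Matrix (Fin n) (Fin n) ℝ}
    (hA : A ∈ orthogonalGroup (Fin n) ℝ) {θ : Fin k → ℝ}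
    (hθ : ∀ i, θ i ∈ Set.Icc 0 (Real.pi / 2)) :
    geodesicDist k (A * signature h * Aᵀ) (A * geodesicPoint h (fun i => 2 * θ i) * Aᵀ) =
      ENNReal.ofReal (2 * √2 * √(∑ i, θ i ^ 2)) := by
  obtain ⟨hc, hl⟩ := isCurveFromTo_geodesicPoint hkm hA θ
  apply le_antisymm
  · refine (iInf₂_le _ hc).trans_eq ?_
    rw [hl]
  · refine le_iInf₂ fun γ hγ => ENNReal.ofReal_le_ofReal ?_
    have e : (1 / 2 : ℝ) • (A * signature h * Aᵀ * (A * geodesicPoint h (fun i => 2 * θ i) * Aᵀ) +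
        A * geodesicPoint h (fun i => 2 * θ i) * Aᵀ * (A * signature h * Aᵀ)) = A *
        diagonal (Sum.elim (fun i => Real.cos (2 * θ i))
          (fun j : Fin m => if h : (j : ℕ) < k then Real.cos (2 * θ ⟨j, h⟩) else 1) ∘
          (finSumFinEquiv.trans (finCongr h)).symm) * Aᵀ := by
      have : ∀ Z, Aᵀ * (A * Z) = Z := fun Z => by
        rw [← mul_assoc, transpose_mul_self_of_mem hA, one_mul]
      rw [← blockMatrix_diagonal]
      change _ = A * blockMatrix h (diagonal fun i => Real.cos (2 * θ i)) 0 0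
        (paddedDiag m fun i => Real.cos (2 * θ i)) * Aᵀ
      rw [← signature_anticommutator_geodesicPoint]
      simp only [mul_assoc, this, mul_add, add_mul, mul_smul_comm, smul_mul_assoc]
    refine le_trans (le_of_eq ?_) (hγ.sqrt_sum_sq_arccos_le hA ?_ e)
    · rw [sum_sumElim_comp _ _ fun y => Real.arccos y ^ 2]
      -- The range of the angles matters here: `θᵢ ≤ π/2` puts `2θᵢ` in `[0, π]`, where `arccos`
      -- inverts `cos`. The padding entries `1` have arccosine `0`.
      have ha : ∀ i, Real.arccos (Real.cos (2 * θ i)) ^ 2 = 4 * θ i ^ 2 := fun i => by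
        rw [Real.arccos_cos (by linarith [(hθ i).1]) (by linarith [(hθ i).2])]
        ring
      rw [Finset.sum_congr rfl (g := fun j : Fin m =>
        if h : (j : ℕ) < k then 4 * θ ⟨j, h⟩ ^ 2 else 0) (s₁ := (Finset.univ : Finset (Fin m)))
        (fun j _ => ?_), sum_dite_lt hkm fun i => 4 * θ i ^ 2]
      · simp only [ha]
        rw [← two_mul, ← Finset.mul_sum,
          show 2 * (4 * ∑ i, θ i ^ 2) = 2 ^ 2 * (2 * ∑ i, θ i ^ 2) by ring,
          Real.sqrt_mul (by norm_num), Real.sqrt_sq zero_le_two, Real.sqrt_mul zero_le_two,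
          mul_assoc]
      · split_ifs
        · exact ha _
        · simp
    · intro i
      simp only [Function.comp_apply]
      generalize (finSumFinEquiv.trans (finCongr h)).symm i = a
      rcases a with a | a
      · exact Real.cos_mem_Icc _
      · simp only [Sum.elim_inr]
        split_ifs
        · exact Real.cos_mem_Icc _
        · norm_num
end
end InvolutionModel

/-! ### Existence of the decompositions, and singular values. -/

namespace InvolutionModel
open Matrix

theorem rectDiag_mul_apply {k m : ℕ} {p : Type*} (hkm : k ≤ m) (v : Fin k → ℝ)
    (Z : Matrix (Fin m) p ℝ) (i : Fin k) (l : p) :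
    (rectDiag m v * Z) i l = v i * Z (Fin.castLE hkm i) l := by
  rw [mul_apply, Finset.sum_eq_single (Fin.castLE hkm i)]
  · simp [rectDiag]
  · intro j _ hj
    have : ¬ (i : ℕ) = j := fun e => hj (Fin.ext e.symm)
    simp [rectDiag, this]
  · simp

theorem rectDiag_self {k : ℕ} (v : Fin k → ℝ) : rectDiag k v = diagonal v := by
  ext i j
  simp [rectDiag, diagonal_apply, Fin.ext_iff]

/-- A matrix with orthogonal rows has a singular value decomposition with trivial left factor. -/
theorem exists_eq_rectDiag_mul {k m : ℕ} (hkm : k ≤ m) {X : Matrix (Fin k) (Fin m) ℝ}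
    {s : Fin k → ℝ} (hX : X * Xᵀ = diagonal fun i => s i ^ 2) :
    ∃ Z ∈ orthogonalGroup (Fin m) ℝ, X = rectDiag m s * Zᵀ := by
  let x : Fin k → EuclideanSpace ℝ (Fin m) := fun i => WithLp.toLp 2 (X i)
  have hx : ∀ i j, inner ℝ (x i) (x j) = if i = j then s i ^ 2 else 0 := by
    intro i j
    have : inner ℝ (x i) (x j) = (X * Xᵀ) i j := by
      rw [mul_apply]
      simp [x, PiLp.inner_apply, mul_comm]
    rw [this, hX, diagonal_apply]
  let v : Fin m → EuclideanSpace ℝ (Fin m) := fun j =>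
    if h : (j : ℕ) < k then (s ⟨j, h⟩)⁻¹ • x ⟨j, h⟩ else 0
  -- Only nonzero rows can be normalised; the others vanish, so any completion to an orthonormal
  -- basis serves for them.
  let S : Set (Fin m) := {j | ∃ h : (j : ℕ) < k, s ⟨j, h⟩ ≠ 0}
  have hv : Orthonormal ℝ (S.domRestrict v) := by
    rw [orthonormal_iff_ite]
    rintro ⟨i, hi, hsi⟩ ⟨j, hj, hsj⟩
    have e : ∀ (j : Fin m) (hj : (j : ℕ) < k), v j = (s ⟨j, hj⟩)⁻¹ • x ⟨j, hj⟩ :=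
      fun j hj => dif_pos hj
    rw [Set.domRestrict_apply, Set.domRestrict_apply, e i hi, e j hj, inner_smul_left,
      inner_smul_right, hx, conj_trivial]
    by_cases hij : i = j
    · subst hij
      simp only [if_true]
      field_simp
    · simp [hij, Fin.ext_iff.not.1 hij]
  obtain ⟨b, hb⟩ := hv.exists_orthonormalBasis_extension_of_card_eq (by simp)
  refine ⟨of fun i j => b j i, ?_, ?_⟩
  · rw [mem_orthogonalGroup_iff']
    ext i j
    have := orthonormal_iff_ite.1 b.orthonormal i j
    rw [PiLp.inner_apply] at this
    rw [mul_apply, one_apply, ← this]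
    simp [mul_comm]
  · ext i l
    rw [rectDiag_mul_apply hkm, transpose_apply, of_apply]
    by_cases hs : s i = 0
    · have : x i = 0 := by rw [← inner_self_eq_zero (𝕜 := ℝ), hx]; simp [hs]
      rw [hs, zero_mul]
      exact congrArg (fun y : EuclideanSpace ℝ (Fin m) => y l) this
    · rw [hb _ ⟨i.2, hs⟩]
      simp [v, x, mul_inv_cancel_left₀ hs]

/-- The first block row determines `U`, `W`, `Z` and `θ`: `W` diagonalises `AᵀA`, whose eigenvalues
are `cos² θᵢ`, then `U` and `Z` come from orthogonal rows. Orthogonality supplies `V` without any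
computation with `C` and `D`. -/
theorem exists_isCSDecomposition {k m n : ℕ} {h : k + m = n} (hkm : k ≤ m)
    {M : Matrix (Fin n) (Fin n) ℝ} (hM : M ∈ orthogonalGroup (Fin n) ℝ) :
    ∃ U W V Z θ, IsCSDecomposition h M U W V Z θ := by
  obtain ⟨A, B, C, D, rfl⟩ := exists_eq_blockMatrix h M
  have h1 := transpose_mul_self_of_mem hM
  have h2 := mul_transpose_self_of_mem hM
  rw [blockMatrix_transpose, blockMatrix_mul, ← blockMatrix_one (h := h), blockMatrix_inj] at h1 h2
  obtain ⟨W, hW, d, hd⟩ := exists_orthogonal_conj_diagonal (A := Aᵀ * A)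
    (by rw [transpose_mul, transpose_transpose])
  have hW1 := transpose_mul_self_of_mem hW
  have hW2 := mul_transpose_self_of_mem hW
  have hd1 : (A * W)ᵀ * (A * W) = diagonal d := by
    rw [transpose_mul, mul_assoc, ← mul_assoc Aᵀ, hd, mul_assoc, mul_assoc, hW1, mul_one,
      ← mul_assoc, hW1, one_mul]
  have hd2 : diagonal d + (C * W)ᵀ * (C * W) = 1 := by
    rw [← hd1, transpose_mul, transpose_mul, Matrix.mul_assoc, Matrix.mul_assoc, ← mul_add,
      ← Matrix.mul_assoc Aᵀ, ← Matrix.mul_assoc Cᵀ, ← add_mul, h1.1, one_mul, hW1]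
  have hd0 : ∀ i, 0 ≤ d i := by
    intro i
    have := congrFun (congrFun hd1 i) i
    rw [diagonal_apply_eq, mul_apply] at this
    rw [← this]
    exact Finset.sum_nonneg fun j _ => mul_self_nonneg _
  have hd1' : ∀ i, d i ≤ 1 := by
    intro i
    have := congrFun (congrFun hd2 i) i
    rw [Matrix.add_apply, diagonal_apply_eq, mul_apply, one_apply_eq] at this
    rw [← this]
    exact le_add_of_nonneg_right (Finset.sum_nonneg fun j _ => mul_self_nonneg _)
  set θ : Fin k → ℝ := fun i => Real.arccos √(d i) with hθ
  have hcos : ∀ i, Real.cos (θ i) ^ 2 = d i := fun i => by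
    rw [hθ, Real.cos_arccos (by linarith [Real.sqrt_nonneg (d i)]) (Real.sqrt_le_one.2 (hd1' i)),
      Real.sq_sqrt (hd0 i)]
  have hsin : ∀ i, Real.sin (θ i) ^ 2 = 1 - d i := fun i => by
    rw [Real.sin_sq, hcos]
  obtain ⟨U, hU, hAU⟩ := exists_eq_rectDiag_mul le_rfl (X := (A * W)ᵀ)
    (s := fun i => Real.cos (θ i)) (by simpa only [transpose_transpose, hcos] using hd1)
  have hU1 := transpose_mul_self_of_mem hU
  have hU2 := mul_transpose_self_of_mem hU
  have hAW : Uᵀ * A * W = diagonal fun i => Real.cos (θ i) := by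
    rw [mul_assoc, ← transpose_transpose (A * W), hAU, rectDiag_self, transpose_mul,
      transpose_transpose, ← mul_assoc, hU1, one_mul, diagonal_transpose]
  obtain ⟨Z, hZ, hBZ⟩ := exists_eq_rectDiag_mul hkm (X := Uᵀ * B)
    (s := fun i => Real.sin (θ i)) (by
      -- The Gram matrix of the rows of `Uᵀ B` is `1 - cos² Θ = sin² Θ`, because `A Aᵀ + B Bᵀ = 1`.
      have e1 : A * Aᵀ = U * (diagonal fun i => Real.cos (θ i)) *
          (U * (diagonal fun i => Real.cos (θ i)))ᵀ := by
        have : A * W = U * diagonal fun i => Real.cos (θ i) := by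
          rw [← hAW, mul_assoc Uᵀ, ← mul_assoc, hU2, one_mul]
        rw [← this, transpose_mul, mul_assoc, ← mul_assoc W, hW2, one_mul]
      have e2 : B * Bᵀ = 1 - A * Aᵀ := eq_sub_of_add_eq' h2.1
      calc Uᵀ * B * (Uᵀ * B)ᵀ = Uᵀ * (B * Bᵀ) * U := by
            rw [transpose_mul, transpose_transpose]; simp only [Matrix.mul_assoc]
        _ = 1 - (Uᵀ * U) * ((diagonal fun i => Real.cos (θ i)) *
            (diagonal fun i => Real.cos (θ i))) * (Uᵀ * U) := by
          rw [e2, e1, mul_sub, mul_one, sub_mul, hU1, transpose_mul, diagonal_transpose, one_mul,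
            mul_one]
          simp only [← mul_assoc, hU1, one_mul]
          rw [mul_assoc, hU1, mul_one]
        _ = _ := by
          rw [hU1, one_mul, mul_one, diagonal_mul_diagonal, ← diagonal_one, diagonal_sub]
          congr 1
          ext i
          rw [← sq, hcos, hsin])
  have hZ1 := transpose_mul_self_of_mem hZ
  have hBZ' : Uᵀ * B * Z = rectDiag m fun i => Real.sin (θ i) := by
    rw [hBZ, Matrix.mul_assoc, hZ1, Matrix.mul_one]
  have hcs := csMiddle_mul_transpose (h := h) hkm θ
  have hcsm := mem_orthogonalGroup_of_mul_transpose hcs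
  set L := blockMatrix h U 0 0 1 with hL
  have hLm : L ∈ orthogonalGroup (Fin n) ℝ := blockMatrix_mem_orthogonalGroup hU (one_mem _)
  set R := blockMatrix h W 0 0 Z with hR
  have hRm : R ∈ orthogonalGroup (Fin n) ℝ := blockMatrix_mem_orthogonalGroup hW hZ
  -- The first block row of `N` equals that of the identity; being orthogonal, `N` is then `diag(1,
  -- V)`.
  set N := Lᵀ * blockMatrix h A B C D * R * (csMiddle h θ)ᵀ with hN
  have hNm : N ∈ orthogonalGroup (Fin n) ℝ :=
    mul_mem (mul_mem (mul_mem (transpose_mem_orthogonalGroup hLm) hM) hRm)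
      (transpose_mem_orthogonalGroup hcsm)
  obtain ⟨E, V, hEV⟩ : ∃ E V, N = blockMatrix h 1 0 E V := by
    rw [csMiddle, blockMatrix_transpose, blockMatrix_mul, ← blockMatrix_one (h := h),
      blockMatrix_inj] at hcs
    obtain ⟨N₁, N₂, E, V, hEV⟩ := exists_eq_blockMatrix h N
    refine ⟨E, V, ?_⟩
    have hEV' := hEV
    rw [hN, hL, hR, csMiddle, blockMatrix_transpose, blockMatrix_transpose, blockMatrix_mul,
      blockMatrix_mul, blockMatrix_mul, blockMatrix_inj] at hEV'
    simp only [transpose_zero, Matrix.zero_mul, Matrix.mul_zero, add_zero, zero_add, hAW,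
      hBZ'] at hEV'
    rw [hEV, ← hEV'.1, ← hEV'.2.1, hcs.1, hcs.2.1]
  have hNN := mul_transpose_self_of_mem hNm
  rw [hEV, blockMatrix_transpose, blockMatrix_mul, ← blockMatrix_one (h := h),
    blockMatrix_inj] at hNN
  have hE : E = 0 := by simpa using hNN.2.2.1
  subst hE
  have hV : V ∈ orthogonalGroup (Fin m) ℝ :=
    mem_orthogonalGroup_of_mul_transpose (by simpa using hNN.2.2.2)
  refine ⟨U, W, V, Z, θ, hU, hW, hV, hZ, fun i => ⟨Real.arccos_nonneg _,
    Real.arccos_le_pi_div_two.2 (Real.sqrt_nonneg _)⟩, ?_⟩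
  have e : blockMatrix h U 0 0 V = L * N := by
    rw [hEV, hL, blockMatrix_mul]
    simp
  rw [e, hN]
  simp only [mul_assoc]
  rw [← mul_assoc _ (csMiddle h θ), transpose_mul_self_of_mem hcsm, one_mul,
    mul_transpose_self_of_mem hRm, mul_one, ← mul_assoc, mul_transpose_self_of_mem hLm, one_mul]

/-- The eigenvalues are `±1` and the trace fixes the number of `+1` as `k`; a permutation `σ` of the
eigenvectors puts those first. -/
theorem exists_isEigendecomposition {k m n : ℕ} {h : k + m = n} {Q : Matrix (Fin n) (Fin n) ℝ}
    (hQ : Q ∈ Gr k n) : ∃ V, IsEigendecomposition h Q V := by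
  have hQQ := mul_self_of_mem_Gr hQ
  obtain ⟨V, hV, d, rfl⟩ := exists_orthogonal_conj_diagonal hQ.2.1
  have hV1 := transpose_mul_self_of_mem hV
  have hd : ∀ i, d i = 1 ∨ d i = -1 := by
    intro i
    have h1 : diagonal d * diagonal d = 1 := by
      calc diagonal d * diagonal d = Vᵀ * (V * diagonal d * Vᵀ * (V * diagonal d * Vᵀ)) * V := by
            have e : ∀ Z, Vᵀ * (V * Z) = Z := fun Z => by rw [← mul_assoc, hV1, one_mul]
            simp only [mul_assoc, e, hV1, mul_one]
        _ = 1 := by rw [hQQ, mul_one, hV1]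
    have := congrFun (congrFun h1 i) i
    rw [diagonal_mul_diagonal, diagonal_apply_eq, one_apply_eq] at this
    exact mul_self_eq_one_iff.1 this
  have htr : ∑ i, d i = 2 * k - n := by
    rw [← hQ.2.2, trace_mul_cycle, hV1, one_mul, trace_diagonal]
  have hc : Fintype.card {i // d i = 1} + Fintype.card {i // ¬ d i = 1} = n := by
    rw [Fintype.card_subtype_compl, Fintype.card_fin]
    have := Fintype.card_subtype_le fun i => d i = 1
    rw [Fintype.card_fin] at this
    omega
  have hk : Fintype.card {i // d i = 1} = k := by
    have e : ∑ i, d i = Fintype.card {i // d i = 1} - Fintype.card {i // ¬ d i = 1} := by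
      have a₁ : ∑ i : {i // d i = 1}, d i = Fintype.card {i // d i = 1} := by
        rw [Finset.sum_congr rfl fun i _ => i.2]
        simp
      have a₂ : ∑ i : {i // ¬ d i = 1}, d i = -Fintype.card {i // ¬ d i = 1} := by
        rw [Finset.sum_congr rfl fun i _ => (hd i.1).resolve_left i.2]
        simp
      rw [← Fintype.sum_subtype_add_sum_subtype (fun i => d i = 1), a₁, a₂, sub_eq_add_neg]
    have hc' : (Fintype.card {i // d i = 1} : ℝ) + Fintype.card {i // ¬ d i = 1} = n := by
      exact_mod_cast hc
    have : (Fintype.card {i // d i = 1} : ℝ) = k := by linarith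
    exact_mod_cast this
  let e₁ : Fin k ≃ {i // d i = 1} := (Fintype.equivFinOfCardEq hk).symm
  let e₂ : Fin m ≃ {i // ¬ d i = 1} := (Fintype.equivFinOfCardEq (by omega)).symm
  let e : Fin k ⊕ Fin m ≃ Fin n := (Equiv.sumCongr e₁ e₂).trans (Equiv.sumCompl fun i => d i = 1)
  let σ : Fin n ≃ Fin n := (finSumFinEquiv.trans (finCongr h)).symm.trans e
  have hs : signature h = (diagonal d).submatrix σ σ := by
    rw [signature, ← diagonal_one, ← diagonal_one, diagonal_neg, blockMatrix_diagonal,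
      submatrix_diagonal_equiv]
    congr 1
    ext i
    simp only [Function.comp_apply, σ, Equiv.trans_apply]
    generalize (finSumFinEquiv.trans (finCongr h)).symm i = a
    rcases a with a | a
    · simpa [e] using (e₁ a).2.symm
    · simpa [e] using ((hd _).resolve_left (e₂ a).2).symm
  refine ⟨V.submatrix id σ, ?_, ?_⟩
  · apply mem_orthogonalGroup_of_mul_transpose
    rw [transpose_submatrix, submatrix_mul_equiv, mul_transpose_self_of_mem hV, submatrix_id_id]
  · rw [hs, transpose_submatrix, submatrix_mul_equiv, submatrix_mul_equiv, submatrix_id_id]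

theorem sum_sq_singularValue {k m : ℕ} (hkm : k ≤ m) (B : Matrix (Fin k) (Fin m) ℝ) :
    ∑ i ∈ Finset.range k, singularValue B i ^ 2 = (Bᵀ * B).trace := by
  set T := toEuclideanLin B with hT
  -- `BᵀB` has `m` eigenvalues, but `B` has rank at most `k`, so the singular values from index `k`
  -- on are zero.
  have h1 : ∑ i ∈ Finset.range k, singularValue B i ^ 2 =
      ∑ i ∈ Finset.range m, singularValue B i ^ 2 := by
    refine Finset.sum_subset (Finset.range_mono hkm) fun i _ hi => ?_
    have : Module.finrank ℝ T.range ≤ i :=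
      (Submodule.finrank_le _).trans (by simpa using hi)
    rw [singularValue, T.singularValues_eq_zero_iff_le_finrank_range.2 this]
    simp
  have hm : Module.finrank ℝ (EuclideanSpace ℝ (Fin m)) = m := by simp
  have h2 := T.isSymmetric_adjoint_comp_self.trace_eq_sum_eigenvalues hm
  have h3 : T.adjoint ∘ₗ T = toEuclideanLin (Bᵀ * B) := by
    rw [hT, ← toEuclideanLin_conjTranspose_eq_adjoint, conjTranspose_eq_transpose_of_trivial]
    exact (toLpLin_mul 2 2 2 _ _).symm
  have h4 : LinearMap.trace ℝ _ (toEuclideanLin (Bᵀ * B)) = (Bᵀ * B).trace := by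
    rw [LinearMap.trace_eq_matrix_trace ℝ (EuclideanSpace.basisFun (Fin m) ℝ).toBasis]
    congr 1
    ext i j
    simp only [LinearMap.toMatrix_apply, OrthonormalBasis.coe_toBasis,
      OrthonormalBasis.coe_toBasis_repr_apply, EuclideanSpace.basisFun_apply,
      EuclideanSpace.basisFun_repr, toLpLin_apply, PiLp.ofLp_single, mulVec_single_one, col_apply]
  rw [h1, Finset.sum_range, ← h4, ← h3, h2]
  refine Finset.sum_congr rfl fun i _ => ?_
  exact T.sq_singularValues_fin hm i

end InvolutionModel

/-! ### Assembly of the theorem. -/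

open InvolutionModel Matrix in
theorem corollary4p5 (k n : ℕ) (hk : 1 ≤ k) (hkn : 2 * k ≤ n) (h : k + (n - k) = n)
    (Q₀ Q₁ : Matrix (Fin n) (Fin n) ℝ)
    (hQ₀ : Q₀ ∈ InvolutionModel.Gr k n) (hQ₁ : Q₁ ∈ InvolutionModel.Gr k n) :
    (∃ V₀ V₁ : Matrix (Fin n) (Fin n) ℝ,
      InvolutionModel.IsEigendecomposition h Q₀ V₀ ∧
      InvolutionModel.IsEigendecomposition h Q₁ V₁) ∧
    ∀ V₀ V₁ : Matrix (Fin n) (Fin n) ℝ,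
      InvolutionModel.IsEigendecomposition h Q₀ V₀ →
      InvolutionModel.IsEigendecomposition h Q₁ V₁ →
      (∃ (U W : Matrix (Fin k) (Fin k) ℝ) (V Z : Matrix (Fin (n - k)) (Fin (n - k)) ℝ)
        (θ : Fin k → ℝ),
        InvolutionModel.IsCSDecomposition h (V₀.transpose * V₁) U W V Z θ) ∧
      ∀ (U W : Matrix (Fin k) (Fin k) ℝ) (V Z : Matrix (Fin (n - k)) (Fin (n - k)) ℝ)
        (θ : Fin k → ℝ) (B : Matrix (Fin k) (Fin (n - k)) ℝ),
        InvolutionModel.IsCSDecomposition h (V₀.transpose * V₁) U W V Z θ →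
        B = (-2 : ℝ) • (U * InvolutionModel.rectDiag (n - k) θ * V.transpose) →
        InvolutionModel.geodesicDist k Q₀ Q₁ =
          ENNReal.ofReal (Real.sqrt 2 *
            Real.sqrt (∑ i ∈ Finset.range k, InvolutionModel.singularValue B i ^ 2)) ∧
        InvolutionModel.geodesicDist k Q₀ Q₁ =
          ENNReal.ofReal (2 * Real.sqrt 2 * Real.sqrt (∑ i, θ i ^ 2)) := by
  have hkm : k ≤ n - k := by omega
  obtain ⟨X₀, hX₀⟩ := exists_isEigendecomposition (h := h) hQ₀
  obtain ⟨X₁, hX₁⟩ := exists_isEigendecomposition (h := h) hQ₁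
  refine ⟨⟨X₀, X₁, hX₀, hX₁⟩, fun V₀ V₁ h₀ h₁ => ⟨exists_isCSDecomposition hkm
    (mul_mem (transpose_mem_orthogonalGroup h₀.mem) h₁.mem), fun U W V Z θ B hcs hB => ?_⟩⟩
  have hD := blockMatrix_mem_orthogonalGroup (h := h) hcs.U_mem hcs.V_mem
  have hE := blockMatrix_mem_orthogonalGroup (h := h) hcs.W_mem hcs.Z_mem
  have hUV := blockMatrix_mul_signature (h := h) U V
  have hWZ := blockMatrix_mul_signature (h := h) W Z
  have hcs' := hcs.eq
  set D := blockMatrix h U 0 0 V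
  set E := blockMatrix h W 0 0 Z
  -- `D` and `E` stabilise the signature under conjugation, so `D` can be absorbed into `V₀`, while
  -- `E` drops out of `Q₁`.
  have e₀ : Q₀ = V₀ * D * signature h * (V₀ * D)ᵀ := by
    rw [mul_assoc V₀, hUV, transpose_mul, ← mul_assoc, ← mul_assoc, mul_assoc _ D,
      mul_transpose_self_of_mem hD, mul_one, h₀.eq]
  have e₁ : Q₁ = V₀ * D * geodesicPoint h (fun i => 2 * θ i) * (V₀ * D)ᵀ := by
    have hV₁ : V₁ = V₀ * D * csMiddle h θ * Eᵀ := by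
      rw [mul_assoc V₀, mul_assoc V₀, ← hcs', ← mul_assoc, mul_transpose_self_of_mem h₀.mem,
        one_mul]
    have hE' : Eᵀ * signature h * E = signature h := by
      rw [mul_assoc, ← hWZ, ← mul_assoc, transpose_mul_self_of_mem hE, one_mul]
    calc Q₁ = V₀ * D * csMiddle h θ * (Eᵀ * signature h * E) * (V₀ * D * csMiddle h θ)ᵀ := by
          rw [h₁.eq, hV₁]
          simp only [transpose_mul, transpose_transpose, mul_assoc]
      _ = _ := by
          rw [hE', ← csMiddle_mul_signature_mul_transpose hkm]
          simp only [transpose_mul, mul_assoc]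
  have hdist : geodesicDist k Q₀ Q₁ = ENNReal.ofReal (2 * √2 * √(∑ i, θ i ^ 2)) := by
    rw [e₀, e₁, geodesicDist_eq hkm (mul_mem h₀.mem hD) hcs.angle_mem]
  refine ⟨?_, hdist⟩
  have hBB : (Bᵀ * B).trace = 2 ^ 2 * ∑ i, θ i ^ 2 := by
    have e : Bᵀ * B = (2 ^ 2 : ℝ) • (V * ((rectDiag (n - k) θ)ᵀ * rectDiag (n - k) θ) * Vᵀ) := by
      rw [hB, transpose_smul, Matrix.smul_mul, Matrix.mul_smul, smul_smul, transpose_mul,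
        transpose_mul, transpose_transpose]
      congr 1
      · norm_num
      · simp only [Matrix.mul_assoc]
        rw [← Matrix.mul_assoc Uᵀ, transpose_mul_self_of_mem hcs.U_mem, Matrix.one_mul]
    rw [e, trace_smul, trace_mul_cycle, transpose_mul_self_of_mem hcs.V_mem, one_mul,
      trace_mul_comm, rectDiag_mul_transpose hkm, trace_diagonal, smul_eq_mul]
    simp [sq]
  rw [hdist, sum_sq_singularValue hkm, hBB, Real.sqrt_mul (by norm_num), Real.sqrt_sq zero_le_two]
  congr 1
  ring
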